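/- **Setting.** Let $\Sigma$ be an ordered alphabet of size $q\ge 2$, let $\mathbf P=(\mathbf P_1,\dots,\mathbf P_q)$ be a vector of non-negative integers, and let $\ell=\sum_i \mathbf P_i\ge 1$. Let $\mathcal L^\Sigma_{\mathbf P}$ be the set of all necklaces (cyclic words, represented by their lexicographically smallest rotation) of length $\ell$ in which the $i$-th letter occurs exactly $\mathbf P_i$ times. For words $\alpha,\beta$, replace each by the power of itself whose length $N$ is the least common multiple of $|\alpha|$ and $|\beta|$, and let $A$, $B$ be the multisets of all cyclic subwords of lengths $1,\dots,N$ of these powers (one for each length and each of the $N$ starting positions). The overlap coefficient is $\mathfrak C(\alpha,\beta)=|A\cap B|/\min(|A|,|B|)$. The overlap distance is $\mathfrak O(\alpha,\beta)=\infty$ if $\mathfrak C=0$, $\mathfrak O(\alpha,\beta)=0$ if $\mathfrak C=1$, and $\mathfrak O(\alpha,\beta)=1/\mathfrak C(\alpha,\beta)$ otherwise. For $1\le k\le|\mathcal L^\Sigma_{\mathbf P}|$ the $k$-centre problem asks for a set $S\subseteq\mathcal L^\Sigma_{\mathbf P}$ with $|S|=k$ that minimises $\max_{v\in\mathcal L^\Sigma_{\mathbf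 P}}\min_{s\in S}\mathfrak O(s,v)$. Let $\mathfrak D_{\mathbf P,k}$ be the minimum. **Prefix-tree algorithm.** Starting from the empty word, build level by level the tree of prefixes of the words in $\mathcal L^\Sigma_{\mathbf P}$, as long as the next level has at most $k$ prefixes and the length is less than $\ell$. Whether a word $p\sigma$ is a prefix is decided by computing the number of necklaces in $\mathcal L^\Sigma_{\mathbf P}$ with prefix $p\sigma$ from the ranks of the smallest and the largest word of length $\ell$ with this prefix. Here the rank of a word $w$ is the number of necklaces in $\mathcal L^\Sigma_{\mathbf P}$ smaller than $w$, and it is computed by dynamic programming. When the next level would have more than $k$ prefixes, choose $k$ of them so that every prefix of the current level is extended by at least one (if length $\ell$ is reached, all words found are the centres). Finally extend each of the chosen prefixes, letter by letter and by means of the same test, to a necklace in $\mathcal L^\Sigma_{\mathbf P}$. **Theorem.** For each $q\ge 2$ there are constants $C,c,d$, depending only on $q$, such that for all $\mathbf P$ with $\ell\ge1$ and all $k$ with $1\le k\le|\mathcal L^\Sigma_{\mathbf P}|$ the prefix-tree algorithm returns a set $S\subseteq \mathcal L^\Sigma_{\mathbf P}$ of exactly $k$ necklaces with $$\max_{v\in\mathcal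 L^\Sigma_{\mathbf P}}\ \min_{s\in S}\ \mathfrak O(s,v)\ \le\ C\cdot\frac{(k\ell)^{2/q}}{\bigl(\log_q(kq)\bigr)^2}\cdot \mathfrak D_{\mathbf P,k},$$ that is, the algorithm has approximation factor $O\bigl(\sqrt[q/2]{k\ell}/\log_q(kq)^2\bigr)$ for fixed $q$; and it uses at most $c\,(k\ell)^d$ elementary steps, where one arithmetic operation on natural numbers counts as one step. -/

import Mathlib

open scoped ENNReal

/-! ### Cyclic words, overlap distance and the `k`-centre problem -/

namespace Necklace

variable {α : Type}

/-- The word `w` repeated `p` times. -/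
def power (w : List α) (p : ℕ) : List α := (List.replicate p w).flatten

/-- The multiset of all cyclic subwords of `w`: for each length `1 ≤ j ≤ |w|`, the subword of
length `j` starting at each of the `|w|` positions (read cyclically), with multiplicity. -/
def subwords (w : List α) : Multiset (List α) :=
  ∑ j ∈ Finset.Icc 1 w.length, (Multiset.range w.length).map fun i => (w.rotate i).take j

/-- The overlap coefficient `|A ∩ B| / min(|A|, |B|)`, with `A`, `B` the multisets of subwords of
the same-length representatives of `u` and `v`.  Labelling the occurrences of a subword by
`1, 2, …` and intersecting the resulting sets is the intersection of multisets. -/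
noncomputable def overlapCoeff [DecidableEq α] (u v : List α) : ℝ≥0∞ :=
  let N := Nat.lcm u.length v.length
  let A := subwords (power u (N / u.length))
  let B := subwords (power v (N / v.length))
  ((A ∩ B).card : ℝ≥0∞) / (min A.card B.card : ℕ)

open Classical in
/-- The overlap distance. -/
noncomputable def overlapDist [DecidableEq α] (u v : List α) : ℝ≥0∞ :=
  if overlapCoeff u v = 0 then ⊤
  else if overlapCoeff u v = 1 then 0
  else 1 / overlapCoeff u v

/-- The largest distance of a word of `L` from its nearest centre in `S`. -/
noncomputable def maxDist [DecidableEq α] (L : Set (List α)) (S : Finset (List α)) : ℝ≥0∞ :=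
  ⨆ v ∈ L, ⨅ s ∈ S, overlapDist s v

/-- The optimal value of the `k`-centre problem for the language `L`. -/
noncomputable def optDist [DecidableEq α] (L : Set (List α)) (k : ℕ) : ℝ≥0∞ :=
  ⨅ (S : Finset (List α)) (_ : (S : Set (List α)) ⊆ L ∧ S.card = k), maxDist L S

/-- Canonical representation of a cyclic word: lexicographically smallest among its rotations.
Cyclic words are identified with their canonical representations. -/
def IsNecklace [LinearOrder α] (w : List α) : Prop := ∀ i < w.length, w ≤ w.rotate i

variable {q : ℕ}

/-- `w` has Parikh vector `P`. -/
def HasContent (P : Fin q → ℕ) (w : List (Fin q)) : Prop := ∀ i, w.count i = P i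

/-- The fixed content cyclic language of all necklaces with Parikh vector `P`. -/
def fixedContent (P : Fin q → ℕ) : Set (List (Fin q)) := {w | IsNecklace w ∧ HasContent P w}

instance (w : List (Fin q)) : Decidable (IsNecklace w) := by unfold IsNecklace; infer_instance

instance (P : Fin q → ℕ) (w : List (Fin q)) : Decidable (HasContent P w) := by
  unfold HasContent; infer_instance

end Necklace

/-! ### Programs with a step count

A value of `Timed α` is a result together with the number of elementary steps (arithmetic
operation on natural numbers, comparison of two letters, copying of a letter, access to a table)
used to obtain it. -/

structure Timed (α : Type) where
  val : α
  cost : ℕ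

namespace Timed

variable {α β : Type}

instance : Monad Timed where
  pure a := ⟨a, 0⟩
  bind x f := ⟨(f x.val).val, x.cost + (f x.val).cost⟩

/-- Spend `n` elementary steps. -/
def tick (n : ℕ) : Timed Unit := ⟨(), n⟩

/-- Apply `f` to the entries of a list in turn. -/
def mapList (f : α → Timed β) : List α → Timed (List β)
  | [] => pure []
  | a :: l => do
      tick 1
      let b ← f a
      let bs ← mapList f l
      pure (b :: bs)

/-- Keep the entries of a list that pass the test `f`. -/
def filterList (f : α → Timed Bool) : List α → Timed (List α)
  | [] => pure []
  | a :: l => do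
      tick 1
      let b ← f a
      let bs ← filterList f l
      pure (if b then a :: bs else bs)

/-- Sum the values of `f` over a list. -/
def sumList (f : α → Timed ℕ) : List α → Timed ℕ
  | [] => pure 0
  | a :: l => do
      tick 1
      let b ← f a
      let s ← sumList f l
      pure (b + s)

/-- Fill a table: compute and store `f a` for each index `a` in the list. -/
def table [DecidableEq α] (f : α → Timed ℕ) : List α → Timed (α → ℕ)
  | [] => pure fun _ => 0
  | a :: l => do
      tick 1
      let b ← f a
      let t ← table f l
      pure (Function.update t a b)

end Timed

/-! ### Ranking necklaces of fixed content -/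

namespace Necklace

open Timed

variable {q : ℕ}

/-- All vectors `Q ≤ P`. -/
def box : {q : ℕ} → (Fin q → ℕ) → List (Fin q → ℕ)
  | 0, P => [P]
  | _ + 1, P => (List.range (P 0 + 1)).flatMap fun a => (box (Fin.tail P)).map (Fin.cons a)

/-- One step of the automaton that checks whether a word has a factor which is smaller than the
prefix of `w` of the same length.  It is in state `s ≤ |w|` when `s` is the largest number such
that the prefix of `w` of length `s` is a suffix of the text read so far.  The letter `c` is read;
the result is `none` if some suffix of the text has become smaller than the prefix of `w` of the
same length, and the new state otherwise.  All suffixes are compared letter by letter. -/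
def step (w : List (Fin q)) (s : ℕ) (c : Fin q) : Timed (Option ℕ) := do
  let u := w.take s ++ [c]
  tick (2 * (s + 2) * (s + 2))
  pure <|
    if ∃ j < s + 2, u.drop (s + 1 - j) < w.take j then none
    else some (Nat.findGreatest (fun j => w.take j <:+ u) (min (s + 1) w.length))

/-- Dynamic programming over automaton states `s` and vectors `Q ≤ P`: the entry `(s, Q)` of the
`m`-th table is the number of words of length `m` and Parikh vector `Q` that lead the automaton
from state `s` to state `s₀` without failure. -/
def pathTable (P : Fin q → ℕ) (w : List (Fin q)) (s₀ : ℕ) : ℕ → Timed (ℕ × (Fin q → ℕ) → ℕ)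
  | 0 =>
      table (fun x => do
          tick (q + 1)
          pure (if x.1 = s₀ ∧ x.2 = 0 then 1 else 0))
        ((List.range (w.length + 1)).product (box P))
  | m + 1 => do
      let T ← pathTable P w s₀ m
      table (fun x =>
          sumList (fun c => do
              tick (q + 1)
              if x.2 c = 0 then pure 0
              else
                match (← step w x.1 c) with
                | none => pure 0
                | some s => pure (T (s, Function.update x.2 c (x.2 c - 1))))
            (List.finRange q))
        ((List.range (w.length + 1)).product (box P))

/-- The number of words `y` with Parikh vector `P` such that some rotation of the periodic word
`y y y …` is smaller than `w`: all words with Parikh vector `P`, minus those that lead the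
automaton of `w` from some state back to the same state without failure. -/
def smallerWords (P : Fin q → ℕ) (w : List (Fin q)) : Timed ℕ := do
  let n := ∑ i, P i
  tick (2 * (n + q + 1))
  let U ← sumList (fun s₀ => do
      let T ← pathTable P w s₀ n
      pure (T (s₀, P)))
    (List.range (w.length + 1))
  pure (Nat.multinomial Finset.univ P - U)

/-- The rank of `w`: the number of necklaces with Parikh vector `P` that are smaller than `w`
(`w` is a word of length `ℓ = ∑ i, P i`).  Up to rotation, words of period `ℓ / d` are words of
length `ℓ / d` with Parikh vector `P / d`, and orbits are counted by averaging over rotations. -/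
def rank (P : Fin q → ℕ) (w : List (Fin q)) : Timed ℕ := do
  let ℓ := ∑ i, P i
  tick (q + 1)
  let s ← sumList (fun d => do
      tick (q + d * d)
      if ∀ i, d ∣ P i then
        let t ← smallerWords (fun i => P i / d) w
        pure (d.totient * t)
      else pure 0)
    ((List.range ℓ).map (· + 1))
  pure (s / ℓ)

/-- The number of necklaces with Parikh vector `P` and prefix `p`, from the ranks of the smallest
and of the largest word with prefix `p`; the largest word may itself be such a necklace. -/
def prefixCount [NeZero q] (P : Fin q → ℕ) (p : List (Fin q)) : Timed ℕ := do
  let ℓ := ∑ i, P i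
  let lo := p ++ List.replicate (ℓ - p.length) (0 : Fin q)
  let hi := p ++ List.replicate (ℓ - p.length) (Fin.rev (0 : Fin q))
  tick (q + 2 * (ℓ + 1))
  let a ← rank P lo
  let b ← rank P hi
  tick ((ℓ + q) * (ℓ + 1))
  pure (b - a + if IsNecklace hi ∧ HasContent P hi then 1 else 0)

/-! ### The prefix tree -/

/-- The extensions of `p` by one letter that are prefixes of a necklace with Parikh vector `P`. -/
def children [NeZero q] (P : Fin q → ℕ) (p : List (Fin q)) : Timed (List (List (Fin q))) :=
  filterList (fun x => do
      tick (p.length + 1)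
      let c ← prefixCount P x
      pure (decide (0 < c)))
    ((List.finRange q).map fun c => p ++ [c])

/-- Build the tree of necklace prefixes level by level, starting from the level `ps`, for at most
`m` further levels.  As soon as the next level has more than `k` prefixes the tree is complete,
and `ps` is the basis of the sample: each prefix in `ps` is extended to one child, and further
children are added until there are `k` prefixes. -/
def grow [NeZero q] (P : Fin q → ℕ) (k : ℕ) : ℕ → List (List (Fin q)) →
    Timed (List (List (Fin q)))
  | 0, ps => pure ps
  | m + 1, ps => do
      let groups ← mapList (children P) ps
      tick ((groups.length + groups.flatten.length + 1) * (∑ i, P i + 1))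
      if groups.flatten.length ≤ k then grow P k m groups.flatten
      else pure ((groups.flatMap (fun g => g.take 1) ++ groups.flatMap List.tail).take k)

/-- Extend the prefix `p` by `m` letters to a necklace. -/
def complete [NeZero q] (P : Fin q → ℕ) : ℕ → List (Fin q) → Timed (List (Fin q))
  | 0, p => pure p
  | m + 1, p => do
      match (← children P p) with
      | [] => pure p
      | c :: _ => complete P m c

/-- The prefix-tree algorithm for the `k`-centre problem on the necklaces with Parikh vector
`P`. -/
def prefixTreeCentres [NeZero q] (P : Fin q → ℕ) (k : ℕ) : Timed (List (List (Fin q))) := do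
  tick (q + 1)
  let ps ← grow P k (∑ i, P i) [[]]
  mapList (fun p => complete P (∑ i, P i - p.length) p) ps

end Necklace

/-!
The approximation factor does not depend on how the centres are chosen: *any* `k` distinct necklaces
achieve it. The content of the first claim is thus that the algorithm does return `k` distinct
necklaces with the given Parikh vector `P`, and that all choices of centres are equally good up to
the stated factor.

*Correctness.* The state of the automaton of `w` is the longest prefix of `w` that ends the text
(`state_append`). Reading `y` can lead it back to the same state only from the state after a long
power of `y`, and it fails on the way if and only if some factor of `y y y …` is smaller than the
prefix of `w` of the same length (`run_eq_some_self_iff`; for the converse, take a shortest such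
factor). Hence the number of loops is the number of words `y` all of whose rotations, continued
periodically, are at least `w` (`smallerWords_val`). Words of period `ℓ / d` are powers of words
with Parikh vector `P / d`, so the sum over `d` with weights `φ(d)` is the sum over all rotations of
their numbers of fixed points, and by orbit counting the algorithm computes ranks (`rank_val`). A
word has prefix `p` if and only if it lies between the smallest and the largest word with this
prefix, so `children` are the necklace prefixes of the next length (`mem_children`), and the rest is
an induction over the levels (`grow_val`, `complete_val`).

*Approximation.* If `k` is the number of all necklaces, every necklace is a centre. Otherwise let
`M` be the most frequent letter and `m ≥ 1` the number of letters other than `M`. At least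
`ℓ - m j` of the cyclic windows of length `j` of any word with this content consist of copies of `M`
only; summing over `j`, two such words share at least a fraction `1 / (8 q m)` of their subwords, so
all distances are at most `8 q m` (`overlapDist_le`). On the other hand, a word of length `J`
contains some letter at least `J / q` times, so a random word with content `P` shows it in a given window
with probability at most `exp (-m J / (q ℓ))`. For `J` slightly above `q ℓ log (k ℓ²) / m` the union
bound over all windows of `k` centres yields a necklace that shares no window of length `J` with any
centre, whence the optimum is at least `m / (q log (k ℓ²))` (`le_optDist`). The quotient of the two
bounds is `8 q² log (k ℓ²)`, and `log (k ℓ²) · log_q(k q)²` is at most a constant times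
`(k ℓ) ^ (2 / q)`, as logarithms grow more slowly than powers (`log_mul_logb_sq_le`).

*Running time.* Every loop contributes the number of its iterations times a bound for its body, and
the tables have at most `(ℓ + 1) ^ (q + 1)` entries; `PolyBounded` collects the polynomial bounds.
-/

namespace Necklace

open Timed

/-! ### Lexicographic order on words -/

section Lex

variable {α : Type} [LinearOrder α]

theorem lt_of_take_lt {u v : List α} {j : ℕ} (h : u.take j < v.take j) : u < v := by
  induction j generalizing u v with
  | zero => simp at h
  | succ j ih =>
    cases u with
    | nil => cases v with
      | nil => simp at h
      | cons b v => exact List.nil_lt_cons b v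
    | cons a u => cases v with
      | nil => simp at h
      | cons b v =>
        simp only [List.take_succ_cons, List.cons_lt_cons_iff] at h ⊢
        exact h.imp id fun h => ⟨h.1, ih h.2⟩

theorem take_le_of_lt {u v : List α} (h : u < v) (j : ℕ) : u.take j ≤ v.take j :=
  le_of_not_gt fun h' => (lt_of_take_lt h').not_gt h

theorem lt_append_of_ne_nil {u v : List α} (hv : v ≠ []) : u < u ++ v := by
  obtain ⟨a, v, rfl⟩ := List.exists_cons_of_ne_nil hv
  simpa using List.append_left_lt (l₁ := u) (List.nil_lt_cons a v)

end Lex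

/-! ### Windows of sequences -/

section Window

variable {α : Type}

/-- The factor of length `j` of the sequence `g` that starts at position `a`. -/
def window (g : ℕ → α) (a j : ℕ) : List α := (List.range j).map fun p => g (a + p)

@[simp] theorem length_window (g : ℕ → α) (a j : ℕ) : (window g a j).length = j := by
  simp [window]

@[simp] theorem getElem_window (g : ℕ → α) (a j p : ℕ) (h : p < (window g a j).length) :
    (window g a j)[p] = g (a + p) := by
  simp [window]

theorem window_add (g : ℕ → α) (a j k : ℕ) :
    window g a (j + k) = window g a j ++ window g (a + j) k := by
  simp [window, List.range_add, Function.comp_def, add_assoc]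

theorem window_succ (g : ℕ → α) (a j : ℕ) :
    window g a (j + 1) = window g a j ++ [g (a + j)] := by
  simp [window, List.range_succ]

theorem window_succ' (g : ℕ → α) (a j : ℕ) :
    window g a (j + 1) = g a :: window g (a + 1) j := by
  rw [add_comm, window_add]; simp [window]

theorem take_window (g : ℕ → α) (a : ℕ) {i j : ℕ} (h : i ≤ j) :
    (window g a j).take i = window g a i := by
  obtain ⟨k, rfl⟩ := Nat.exists_eq_add_of_le h
  rw [window_add, List.take_left' (by simp)]

theorem window_congr {g : ℕ → α} {a b : ℕ} (h : ∀ p, g (a + p) = g (b + p)) (j : ℕ) :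
    window g a j = window g b j := by
  simp [window, h]

theorem window_suffix (g : ℕ → α) {i j : ℕ} (h : i ≤ j) :
    window g (j - i) i <:+ window g 0 j := by
  refine ⟨window g 0 (j - i), ?_⟩
  have := window_add g 0 (j - i) i
  rw [Nat.sub_add_cancel h, zero_add] at this
  exact this.symm

end Window

section Periodic

variable {q : ℕ} [NeZero q]

/-- The periodic sequence `y y y …`. -/
def periodic (y : List (Fin q)) (p : ℕ) : Fin q := y.getD (p % y.length) 0

theorem periodic_mod (y : List (Fin q)) (p : ℕ) : periodic y (p % y.length) = periodic y p := by
  simp [periodic]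

theorem periodic_congr {y : List (Fin q)} {a b : ℕ} (h : a ≡ b [MOD y.length]) :
    periodic y a = periodic y b := by
  unfold periodic; rw [h]

theorem window_periodic_congr {y : List (Fin q)} {a b : ℕ} (h : a ≡ b [MOD y.length]) (j : ℕ) :
    window (periodic y) a j = window (periodic y) b j :=
  window_congr (fun p => periodic_congr (h.add_right p)) j

theorem window_periodic_length (y : List (Fin q)) (i : ℕ) :
    window (periodic y) i y.length = y.rotate i := by
  apply List.ext_getElem (by simp)
  intro p h1 h2
  have hy : 0 < y.length := by simp at h1; omega
  rw [getElem_window, List.getElem_rotate, periodic, List.getD_eq_getElem _ _ (Nat.mod_lt _ hy)]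
  simp only [add_comm]

theorem length_power {α : Type} (y : List α) (d : ℕ) : (power y d).length = d * y.length := by
  simp [power]

theorem power_succ {α : Type} (y : List α) (d : ℕ) : power y (d + 1) = y ++ power y d := by
  simp [power, List.replicate_succ]

theorem power_one {α : Type} (y : List α) : power y 1 = y := by simp [power]

theorem window_periodic_zero (y : List (Fin q)) (d : ℕ) :
    window (periodic y) 0 (d * y.length) = power y d := by
  induction d with
  | zero => simp [power, window]
  | succ d ih =>
    rw [power_succ, ← ih, add_mul, one_mul, add_comm, window_add, window_periodic_length]
    simp only [List.rotate_zero, zero_add]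
    congr 1
    exact window_periodic_congr (by simp [Nat.ModEq]) _

theorem periodic_power (y : List (Fin q)) {d : ℕ} (hd : d ≠ 0) :
    periodic (power y d) = periodic y := by
  funext p
  rcases Nat.eq_zero_or_pos y.length with h | h
  · obtain rfl := List.length_eq_zero_iff.1 h
    simp [periodic, power]
  · have hl : 0 < d * y.length := by positivity
    have hp : p % (d * y.length) < d * y.length := Nat.mod_lt _ hl
    conv_lhs => rw [periodic, length_power, ← window_periodic_zero,
      List.getD_eq_getElem _ _ (by simpa using hp), getElem_window, zero_add]
    exact periodic_congr ((Nat.mod_modEq _ _).of_mul_left _)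

end Periodic

/-! ### The automaton of a word -/

section Automaton

variable {α : Type}

theorem power_append_comm (y : List α) (d : ℕ) : y ++ power y d = power y d ++ y := by
  induction d with
  | zero => simp [power]
  | succ d ih => rw [power_succ, List.append_assoc, ← ih]

variable [DecidableEq α]

/-- The state of the automaton of `w` after the text `t`: the largest `j ≤ |w|` such that the
prefix of `w` of length `j` is a suffix of `t`. -/
def state (w t : List α) : ℕ := Nat.findGreatest (fun j => w.take j <:+ t) w.length

theorem state_le (w t : List α) : state w t ≤ w.length := Nat.findGreatest_le _

theorem take_state_suffix (w t : List α) : w.take (state w t) <:+ t := by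
  have : w.take 0 <:+ t := by simp
  exact Nat.findGreatest_spec (P := fun j => w.take j <:+ t) (Nat.zero_le _) this

theorem le_state {w t : List α} {j : ℕ} (hj : j ≤ w.length) (h : w.take j <:+ t) :
    j ≤ state w t := Nat.le_findGreatest (P := fun j => w.take j <:+ t) hj h

theorem state_eq {w t t' : List α} (h : ∀ j ≤ w.length, w.take j <:+ t ↔ w.take j <:+ t') :
    state w t = state w t' :=
  le_antisymm (le_state (state_le _ _) ((h _ (state_le _ _)).1 (take_state_suffix _ _)))
    (le_state (state_le _ _) ((h _ (state_le _ _)).2 (take_state_suffix _ _)))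

theorem state_take {w : List α} {s : ℕ} (hs : s ≤ w.length) : state w (w.take s) = s := by
  refine le_antisymm ?_ (le_state hs (List.suffix_refl _))
  have := (take_state_suffix w (w.take s)).length_le
  have h := state_le w (w.take s)
  simp only [List.length_take] at this
  omega

/-- Only the longest prefix of `w` that ends the text matters for how the text continues. -/
theorem state_append (w t y : List α) : state w (t ++ y) = state w (w.take (state w t) ++ y) := by
  refine state_eq fun j hj => ⟨fun h => ?_, fun h => ?_⟩
  · rcases le_total j y.length with hjy | hjy
    · have : w.take j <:+ y :=
        List.suffix_of_suffix_length_le h (List.suffix_append _ _) (by simp; omega)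
      exact this.trans (List.suffix_append _ _)
    · obtain ⟨i, rfl⟩ := Nat.exists_eq_add_of_le' hjy
      obtain ⟨r, hr⟩ := h
      have hy : y <:+ w.take (i + y.length) :=
        List.suffix_of_suffix_length_le (List.suffix_append t y) ⟨r, hr⟩ (by simp; omega)
      obtain ⟨x, hx⟩ := hy
      have hxl : x.length = i := by
        have := congrArg List.length hx
        simp only [List.length_append, List.length_take] at this
        omega
      have hxw : x = w.take i := by
        have := congrArg (List.take i) hx
        rwa [List.take_left' hxl, List.take_take, min_eq_left (by omega)] at this
      have hxt : w.take i <:+ t := by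
        rw [← hx, ← List.append_assoc] at hr
        exact ⟨r, by rw [← hxw]; exact List.append_cancel_right hr⟩
      have hi : i ≤ state w t := le_state (by omega) hxt
      have : w.take i <:+ w.take (state w t) :=
        List.suffix_of_suffix_length_le hxt (take_state_suffix w t) (by simp; omega)
      rw [← hx, hxw]
      exact List.suffix_append_self_iff.2 this
  · refine h.trans ?_
    exact List.suffix_append_self_iff.2 (take_state_suffix w t)

theorem state_append_of_length_le (w t : List α) {x : List α} (h : w.length ≤ x.length) :
    state w (t ++ x) = state w x := by
  refine state_eq fun j hj => ⟨fun h' => ?_, fun h' => h'.trans (List.suffix_append _ _)⟩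
  exact List.suffix_of_suffix_length_le h' (List.suffix_append _ _) (by simp; omega)

/-- The only state to which the automaton may return after reading `y` is its state after a long
power of `y`. -/
theorem state_loop_iff {w y : List α} {s d : ℕ} (hs : s ≤ w.length)
    (hd : w.length ≤ (power y d).length) :
    state w (w.take s ++ y) = s ↔ s = state w (power y d) := by
  constructor
  · intro h
    have key : ∀ m, state w (w.take s ++ power y m) = s := by
      intro m
      induction m with
      | zero => simpa [power] using state_take hs
      | succ m ih =>
        rw [power_succ, power_append_comm, ← List.append_assoc, state_append, ih, h]
    rw [← state_append_of_length_le w (w.take s) hd, key]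
  · rintro rfl
    rw [← state_append, ← power_append_comm, state_append_of_length_le _ _ hd]

end Automaton

section Run

variable {q : ℕ}

/-- The check that the automaton of `w` makes in state `s` when it reads `c` fails: some suffix of
the text is smaller than the prefix of `w` of the same length. -/
def Fails (w : List (Fin q)) (s : ℕ) (c : Fin q) : Prop :=
  ∃ j < s + 2, (w.take s ++ [c]).drop (s + 1 - j) < w.take j

/-- The state that the automaton of `w` reaches from state `s` by reading a word, if it does not
fail. -/
def run (w : List (Fin q)) : ℕ → List (Fin q) → Option ℕ
  | s, [] => some s
  | s, c :: y => (step w s c).val.bind fun s' => run w s' y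

open Classical in
theorem step_val {w : List (Fin q)} {s : ℕ} (hs : s ≤ w.length) (c : Fin q) :
    (step w s c).val = if Fails w s c then none else some (state w (w.take s ++ [c])) := by
  have : Nat.findGreatest (fun j => w.take j <:+ w.take s ++ [c]) (min (s + 1) w.length) =
      state w (w.take s ++ [c]) := by
    rw [Nat.findGreatest_eq_iff]
    refine ⟨le_min ?_ (state_le _ _), fun _ => take_state_suffix _ _,
      fun n hn hn' h => hn.not_ge (le_state (by omega) h)⟩
    have h1 := (take_state_suffix w (w.take s ++ [c])).length_le
    have h2 := state_le w (w.take s ++ [c])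
    simp only [List.length_take, List.length_append, List.length_singleton] at h1
    omega
  rw [← this]
  simp only [step, bind, pure]
  by_cases hF : Fails w s c
  · rw [if_pos hF]; exact if_pos hF
  · rw [if_neg hF]; exact if_neg hF

/-- Runs of the automaton over a sequence. -/
theorem run_window_eq_some (w : List (Fin q)) (g : ℕ → Fin q) (t r s : ℕ) :
    run w (state w (window g 0 t)) (window g t r) = some s ↔
      state w (window g 0 (t + r)) = s ∧
        ∀ i < r, ¬ Fails w (state w (window g 0 (t + i))) (g (t + i)) := by
  induction r generalizing t with
  | zero => simp [window, run]
  | succ r ih =>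
    rw [window_succ', run, step_val (state_le _ _)]
    by_cases hF : Fails w (state w (window g 0 t)) (g t)
    · simp only [hF, if_true, Option.bind_none, reduceCtorEq, false_iff, not_and, not_forall]
      exact fun _ => ⟨0, Nat.succ_pos r, not_not.2 hF⟩
    · rw [if_neg hF, Option.bind_some, ← state_append]
      have : window g 0 t ++ [g t] = window g 0 (t + 1) := by rw [window_succ, zero_add]
      rw [this, ih, show t + 1 + r = t + (r + 1) by omega]
      refine and_congr_right fun _ => ⟨fun h i hi => ?_, fun h i hi => ?_⟩
      · cases i with
        | zero => exact hF
        | succ i => rw [show t + (i + 1) = t + 1 + i by omega]; exact h i (by omega)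
      · have := h (i + 1) (by omega)
        rwa [show t + (i + 1) = t + 1 + i by omega] at this

theorem window_lt_of_fails {w : List (Fin q)} {g : ℕ → Fin q} {t : ℕ}
    (h : Fails w (state w (window g 0 t)) (g t)) :
    ∃ a, ∃ j ≤ w.length, window g a j < w.take j := by
  obtain ⟨j, hj, hlt⟩ := h
  set s := state w (window g 0 t) with hs
  have hsw : s ≤ w.length := state_le _ _
  have hjw : j ≤ w.length := by
    by_contra hjw
    -- then `s = |w|` and the whole of `w` followed by a letter would be smaller than `w`
    have h1 : s = w.length := by omega
    have h2 : s + 1 - j = 0 := by omega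
    rw [h2, h1, List.drop_zero, List.take_length, List.take_of_length_le (by omega)] at hlt
    exact (lt_append_of_ne_nil (List.cons_ne_nil _ _)).not_gt hlt
  have hsuf : w.take s ++ [g t] <:+ window g 0 (t + 1) := by
    rw [window_succ, zero_add]
    exact List.suffix_append_self_iff.2 (take_state_suffix _ _)
  have hst : s + 1 ≤ t + 1 := by
    have := hsuf.length_le
    simp only [List.length_append, List.length_take, List.length_singleton, length_window] at this
    omega
  have hlen : ((w.take s ++ [g t]).drop (s + 1 - j)).length = j := by
    simp only [List.length_drop, List.length_append, List.length_take, List.length_singleton]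
    omega
  have heq : (w.take s ++ [g t]).drop (s + 1 - j) = window g (t + 1 - j) j :=
    List.IsSuffix.eq_of_length (List.suffix_of_suffix_length_le
      ((List.drop_suffix _ _).trans hsuf) (window_suffix g (by omega)) (by simp [hlen]))
      (by simp [hlen])
  exact ⟨t + 1 - j, j, hjw, heq ▸ hlt⟩

theorem append_singleton_lt {α : Type} [LinearOrder α] {u v : List α} {c d : α}
    (h : u.length = v.length) (hlt : u ++ [c] < v ++ [d]) : u ≤ v := by
  have := take_le_of_lt hlt u.length
  rwa [List.take_left' rfl, List.take_left' h.symm] at this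

/-- A shortest factor that is smaller than the prefix of `w` of the same length makes the automaton
fail when its last letter is read. -/
theorem fails_of_window_lt {w : List (Fin q)} {g : ℕ → Fin q} {a j : ℕ} (hj : j + 1 ≤ w.length)
    (hlt : window g a (j + 1) < w.take (j + 1))
    (hmin : ¬ window g a j < w.take j) :
    Fails w (state w (window g 0 (a + j))) (g (a + j)) := by
  have hsuf : window g a j <:+ window g 0 (a + j) := by
    simpa using window_suffix g (Nat.le_add_left j a)
  have heq : window g a j = w.take j := by
    rw [window_succ, List.take_succ_eq_append_getElem (by omega)] at hlt
    exact (append_singleton_lt (by simp; omega) hlt).antisymm (not_lt.1 hmin)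
  have hs : j ≤ state w (window g 0 (a + j)) := le_state (by omega) (heq ▸ hsuf)
  refine ⟨j + 1, by omega, ?_⟩
  set s := state w (window g 0 (a + j)) with hs'
  have hsw : s ≤ w.length := state_le _ _
  convert hlt using 1
  have hsuf2 : w.take s ++ [g (a + j)] <:+ window g 0 (a + j + 1) := by
    rw [window_succ, zero_add]
    exact List.suffix_append_self_iff.2 (take_state_suffix _ _)
  have hlen : ((w.take s ++ [g (a + j)]).drop (s + 1 - (j + 1))).length = j + 1 := by
    simp only [List.length_drop, List.length_append, List.length_take, List.length_singleton]
    omega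
  have h3 : window g a (j + 1) <:+ window g 0 (a + j + 1) := by
    simpa [add_assoc] using window_suffix g (Nat.le_add_left (j + 1) a)
  exact List.IsSuffix.eq_of_length (List.suffix_of_suffix_length_le
      ((List.drop_suffix _ _).trans hsuf2) h3 (by rw [hlen, length_window]))
      (by rw [hlen, length_window])

variable [NeZero q]

theorem state_append_of_run {w y : List (Fin q)} {s s' : ℕ} (hs : s ≤ w.length)
    (h : run w s y = some s') : state w (w.take s ++ y) = s' := by
  set t := w.take s ++ y with ht
  have h0 : window (periodic t) 0 t.length = t := by rw [window_periodic_length, List.rotate_zero]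
  have hlen : (w.take s).length = s := by simpa using hs
  have hl : t.length = s + y.length := by rw [ht, List.length_append, hlen]
  rw [hl, window_add, zero_add] at h0
  obtain ⟨h1, h2⟩ := List.append_inj h0 (by simp [hlen])
  have h3 : state w (window (periodic t) 0 s) = s := by rw [h1, state_take hs]
  rw [← h3, ← h2, run_window_eq_some] at h
  rw [← h.1, window_add, h1, zero_add, h2]

/-- Reading `y` leads the automaton of `w` from a state back to the same state only if the state is
the one after a long power of `y`, and if no factor of `y y y …` is smaller than the prefix of `w`
of the same length. -/
theorem run_eq_some_self_iff {w y : List (Fin q)} {d s : ℕ} (hd : w.length = d * y.length)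
    (hw : w ≠ []) (hs : s ≤ w.length) :
    run w s y = some s ↔
      s = state w (power y d) ∧ ¬ ∃ i, window (periodic y) i w.length < w := by
  have hwl : 0 < w.length := List.length_pos_iff.2 hw
  have hy : 0 < y.length := Nat.pos_of_mul_pos_left (hd ▸ hwl)
  set g := periodic y with hg
  have hpow : power y d = window g 0 w.length := by rw [hd, window_periodic_zero]
  have hyw : window g w.length y.length = y := by
    rw [window_periodic_length, hd, mul_comm, List.rotate_length_mul]
  have hd' : w.length ≤ (power y d).length := by rw [hpow, length_window]
  have hstate : run w s y = some s → s = state w (power y d) := fun h =>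
    (state_loop_iff hs hd').1 (state_append_of_run hs h)
  suffices h : s = state w (power y d) → (run w s y = some s ↔ ¬ ∃ i, window g i w.length < w) from
    ⟨fun h' => ⟨hstate h', (h (hstate h')).1 h'⟩, fun h' => (h h'.1).2 h'.2⟩
  rintro rfl
  have hrun := run_window_eq_some w g w.length y.length (state w (power y d))
  rw [hyw, ← hpow] at hrun
  rw [hrun, window_add, ← hpow, zero_add, hyw, ← power_append_comm,
    state_append_of_length_le _ _ hd', and_iff_right rfl]
  constructor
  · rintro h ⟨i, hi⟩
    have hex : ∃ j, ∃ a, window g a j < w.take j := ⟨w.length, i, by rwa [List.take_length]⟩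
    classical
    obtain ⟨a, ha⟩ := Nat.find_spec hex
    have hle : Nat.find hex ≤ w.length := Nat.find_min' hex ⟨i, by rwa [List.take_length]⟩
    have hmin : ∀ j < Nat.find hex, ∀ a, ¬ window g a j < w.take j :=
      fun j hj a ha => Nat.find_min hex hj ⟨a, ha⟩
    generalize Nat.find hex = j at *
    obtain _ | j := j
    · simp [window] at ha
    -- move the factor so that it ends within the last copy of `y`
    have hr : (a + j) % y.length < y.length := Nat.mod_lt _ hy
    set r := (a + j) % y.length with hrdef
    have hmod : a ≡ w.length + r - j [MOD y.length] := by
      refine Nat.ModEq.add_right_cancel' j ?_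
      rw [Nat.sub_add_cancel (by omega), hd]
      simp [Nat.ModEq, hrdef]
    rw [window_periodic_congr hmod] at ha
    have := fails_of_window_lt hle ha (hmin j (Nat.lt_succ_self j) _)
    rw [Nat.sub_add_cancel (by omega)] at this
    exact h r hr this
  · rintro h i - hF
    obtain ⟨a, j, hj, hlt⟩ := window_lt_of_fails hF
    rw [← take_window g a hj] at hlt
    exact h ⟨a, lt_of_take_lt hlt⟩

open Classical in
/-- The automaton of `w` returns after reading `y` to exactly one state if no factor of `y y y …` is
smaller than the prefix of `w` of the same length, and to none otherwise. -/
theorem card_loops {w y : List (Fin q)} {d : ℕ} (hd : w.length = d * y.length) (hw : w ≠ []) :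
    ((Finset.range (w.length + 1)).filter fun s => run w s y = some s).card =
      if ∃ i, window (periodic y) i w.length < w then 0 else 1 := by
  have h : ∀ s ∈ Finset.range (w.length + 1), run w s y = some s ↔
      s = state w (power y d) ∧ ¬ ∃ i, window (periodic y) i w.length < w := fun s hs =>
    run_eq_some_self_iff hd hw (Nat.lt_succ_iff.1 (Finset.mem_range.1 hs))
  rw [Finset.filter_congr h]
  split_ifs with hbad
  · simp [hbad]
  · rw [Finset.card_eq_one]
    refine ⟨state w (power y d), ?_⟩
    ext s
    have := state_le w (power y d)
    simp only [Finset.mem_filter, Finset.mem_range, Finset.mem_singleton]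
    exact ⟨fun h => h.2.1, fun h => ⟨by omega, h, hbad⟩⟩

end Run

/-! ### Counting words of given content -/

section Words

variable {q : ℕ}

/-- All words of length `n`. -/
def words : ℕ → Finset (List (Fin q))
  | 0 => {[]}
  | n + 1 => (Finset.univ ×ˢ words n).image fun x => x.1 :: x.2

@[simp] theorem mem_words {n : ℕ} {y : List (Fin q)} : y ∈ words n ↔ y.length = n := by
  induction n generalizing y with
  | zero => simp [words]
  | succ n ih => cases y <;> simp [words, ih]

theorem sum_words_succ (n : ℕ) (f : List (Fin q) → ℕ) :
    ∑ y ∈ words (n + 1), f y = ∑ c, ∑ y ∈ words n, f (c :: y) := by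
  rw [words, Finset.sum_image fun x _ y _ h => by simpa [Prod.ext_iff] using h,
    Finset.sum_product]

theorem HasContent.length_eq {P : Fin q → ℕ} {y : List (Fin q)} (h : HasContent P y) :
    y.length = ∑ i, P i := by
  rw [← Finset.sum_congr rfl fun i _ => h i]
  simpa using (List.sum_toFinset_count_eq_length y).symm.trans
    (Finset.sum_subset (Finset.subset_univ _) fun i _ hi =>
      List.count_eq_zero.2 (by simpa using hi))

theorem hasContent_cons {P : Fin q → ℕ} {c : Fin q} {y : List (Fin q)} :
    HasContent P (c :: y) ↔ P c ≠ 0 ∧ HasContent (Function.update P c (P c - 1)) y := by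
  constructor
  · intro h
    refine ⟨?_, fun i => ?_⟩
    · rw [← h c]; simp
    · rcases eq_or_ne i c with rfl | hi
      · simp [← h i]
      · simp [Function.update_of_ne hi, ← h i, List.count_cons_of_ne (Ne.symm hi)]
  · rintro ⟨h0, h⟩ i
    rcases eq_or_ne i c with rfl | hi
    · have := h i
      simp only [Function.update_self] at this
      simp only [List.count_cons_self, this]
      omega
    · have := h i
      rw [Function.update_of_ne hi] at this
      rw [List.count_cons_of_ne (Ne.symm hi), this]

theorem hasContent_nil {P : Fin q → ℕ} : HasContent P [] ↔ P = 0 := by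
  simp [HasContent, funext_iff, eq_comm]

theorem HasContent.rotate {P : Fin q → ℕ} {y : List (Fin q)} (h : HasContent P y) (i : ℕ) :
    HasContent P (y.rotate i) := fun c => by
  rw [(List.rotate_perm y i).count_eq, h c]

/-- All words with Parikh vector `P`. -/
def contentWords (P : Fin q → ℕ) : Finset (List (Fin q)) :=
  (words (∑ i, P i)).filter (HasContent P)

@[simp] theorem mem_contentWords {P : Fin q → ℕ} {y : List (Fin q)} :
    y ∈ contentWords P ↔ HasContent P y := by
  simp only [contentWords, Finset.mem_filter, mem_words]
  exact ⟨fun h => h.2, fun h => ⟨h.length_eq, h⟩⟩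

theorem sum_update_sub_one {P : Fin q → ℕ} {c : Fin q} (hc : P c ≠ 0) :
    ∑ i, Function.update P c (P c - 1) i + 1 = ∑ i, P i := by
  rw [Finset.sum_update_of_mem (Finset.mem_univ c),
    ← Finset.add_sum_erase _ P (Finset.mem_univ c), Finset.sdiff_singleton_eq_erase]
  omega

theorem multinomial_update_mul {P : Fin q → ℕ} {c : Fin q} (hc : P c ≠ 0) :
    Nat.multinomial Finset.univ (Function.update P c (P c - 1)) * ∑ i, P i =
      Nat.multinomial Finset.univ P * P c := by
  have h1 := Nat.multinomial_spec Finset.univ P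
  have h2 := Nat.multinomial_spec Finset.univ (Function.update P c (P c - 1))
  have hs := sum_update_sub_one hc
  have hp : (∏ i, (Function.update P c (P c - 1) i).factorial) * P c =
      ∏ i, (P i).factorial := by
    rw [← Finset.mul_prod_erase _ _ (Finset.mem_univ c),
      ← Finset.mul_prod_erase _ (fun i => (P i).factorial) (Finset.mem_univ c)]
    rw [Finset.prod_congr rfl (g := fun i => (P i).factorial) fun i hi => by
      rw [Function.update_of_ne (Finset.ne_of_mem_erase hi)]]
    rw [Function.update_self, ← Nat.mul_factorial_pred hc]
    ring
  have hpos : 0 < ∏ i, (Function.update P c (P c - 1) i).factorial :=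
    Finset.prod_pos fun i _ => Nat.factorial_pos _
  refine Nat.eq_of_mul_eq_mul_left hpos ?_
  rw [← mul_assoc, h2, ← hs, mul_comm, ← Nat.factorial_succ, hs, ← h1, ← hp]
  ring

theorem card_contentWords (P : Fin q → ℕ) :
    (contentWords P).card = Nat.multinomial Finset.univ P := by
  generalize hn : ∑ i, P i = n
  induction n generalizing P with
  | zero =>
    have hP : P = 0 := by
      funext i; simpa using (Finset.sum_eq_zero_iff.1 hn) i (Finset.mem_univ i)
    have : contentWords P = {[]} := by
      ext y
      rw [mem_contentWords, Finset.mem_singleton]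
      refine ⟨fun h => List.length_eq_zero_iff.1 (h.length_eq.trans hn), ?_⟩
      rintro rfl
      exact hasContent_nil.2 hP
    rw [this, hP]
    simp [Nat.multinomial]
  | succ n ih =>
    have h1 : (contentWords P).card =
        ∑ c, if P c = 0 then 0 else
          Nat.multinomial Finset.univ (Function.update P c (P c - 1)) := by
      rw [contentWords, hn, Finset.card_filter, sum_words_succ]
      refine Finset.sum_congr rfl fun c _ => ?_
      split_ifs with hc
      · simp [hasContent_cons, hc]
      · have hs := sum_update_sub_one hc
        rw [← ih _ (by omega), contentWords, show ∑ i, Function.update P c (P c - 1) i = n by omega,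
          Finset.card_filter]
        simp [hasContent_cons, hc]
    refine Nat.eq_of_mul_eq_mul_right (Nat.succ_pos n) ?_
    rw [h1, Nat.succ_eq_add_one, Finset.sum_mul]
    have h2 : ∀ c, (if P c = 0 then 0 else
          Nat.multinomial Finset.univ (Function.update P c (P c - 1))) * (n + 1) =
        Nat.multinomial Finset.univ P * P c := fun c => by
      split_ifs with hc
      · simp [hc]
      · rw [← hn, multinomial_update_mul hc]
    rw [Finset.sum_congr rfl fun c _ => h2 c, ← Finset.mul_sum, hn]

end Words

/-! ### The values of the table computations -/

section Values

variable {α β : Type}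

@[simp] theorem _root_.Timed.val_pure (a : α) : (pure a : Timed α).val = a := rfl

@[simp] theorem _root_.Timed.val_bind (x : Timed α) (f : α → Timed β) :
    (x >>= f).val = (f x.val).val := rfl

@[simp] theorem _root_.Timed.val_mapList (f : α → Timed β) (l : List α) :
    (mapList f l).val = l.map fun a => (f a).val := by
  induction l with
  | nil => rfl
  | cons a l ih => simp [mapList, ih]

@[simp] theorem _root_.Timed.val_filterList (f : α → Timed Bool) (l : List α) :
    (filterList f l).val = l.filter fun a => (f a).val := by
  induction l with
  | nil => rfl
  | cons a l ih => simp [filterList, ih, List.filter_cons]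

@[simp] theorem _root_.Timed.val_sumList (f : α → Timed ℕ) (l : List α) :
    (sumList f l).val = (l.map fun a => (f a).val).sum := by
  induction l with
  | nil => rfl
  | cons a l ih => simp [sumList, ih]

theorem _root_.Timed.val_table [DecidableEq α] (f : α → Timed ℕ) {l : List α} {a : α}
    (h : a ∈ l) : (table f l).val a = (f a).val := by
  induction l with
  | nil => simp at h
  | cons b l ih =>
    simp only [table, val_bind, val_pure]
    rcases eq_or_ne a b with rfl | hab
    · simp
    · rw [Function.update_of_ne hab]
      exact ih (by simpa [hab] using h)

end Values

/-! ### Counting by dynamic programming -/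

section Tables

theorem mem_box : ∀ {q : ℕ} {P Q : Fin q → ℕ}, Q ∈ box P ↔ ∀ i, Q i ≤ P i
  | 0, P, Q => by simp [box, Subsingleton.elim Q P]
  | q + 1, P, Q => by
    simp only [box, List.mem_flatMap, List.mem_range, List.mem_map, mem_box]
    constructor
    · rintro ⟨a, ha, R, hR, rfl⟩ i
      refine Fin.cases ?_ (fun i => ?_) i
      · simpa using Nat.lt_succ_iff.1 ha
      · exact hR i
    · intro h
      exact ⟨Q 0, Nat.lt_succ_of_le (h 0), Fin.tail Q, fun i => h i.succ, Fin.cons_self_tail Q⟩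

variable {q : ℕ}

theorem mem_tableIndices {w : List (Fin q)} {s : ℕ} {P Q : Fin q → ℕ} (hs : s ≤ w.length)
    (hQ : ∀ i, Q i ≤ P i) : (s, Q) ∈ (List.range (w.length + 1)).product (box P) :=
  List.mem_product.2 ⟨List.mem_range.2 (Nat.lt_succ_of_le hs), mem_box.2 hQ⟩

theorem le_of_step {w : List (Fin q)} {s s' : ℕ} (hs : s ≤ w.length) {c : Fin q}
    (h : (step w s c).val = some s') : s' ≤ w.length := by
  rw [step_val hs] at h
  split_ifs at h
  exact Option.some.inj h ▸ state_le _ _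

/-- The entries of the tables count words, by splitting off the first letter. -/
theorem pathTable_val {P : Fin q → ℕ} {w : List (Fin q)} (s₀ m : ℕ) {s : ℕ} {Q : Fin q → ℕ}
    (hs : s ≤ w.length) (hQ : ∀ i, Q i ≤ P i) :
    (pathTable P w s₀ m).val (s, Q) =
      ((words m).filter fun y => HasContent Q y ∧ run w s y = some s₀).card := by
  induction m generalizing s Q with
  | zero =>
    rw [pathTable, val_table _ (mem_tableIndices hs hQ), Finset.card_filter]
    rw [words, Finset.sum_singleton]
    simp [hasContent_nil, run, and_comm]
  | succ m ih =>
    rw [pathTable, val_bind, val_table _ (mem_tableIndices hs hQ), val_sumList, Finset.card_filter,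
      sum_words_succ, ← List.ofFn_eq_map, List.sum_ofFn]
    refine Finset.sum_congr rfl fun c _ => ?_
    simp only [val_bind, hasContent_cons, run]
    by_cases hc : Q c = 0
    · simp [hc]
    · rw [if_neg hc]
      simp only [val_bind]
      cases h : (step w s c).val with
      | none => simp
      | some s' =>
        have hQ' : ∀ i, Function.update Q c (Q c - 1) i ≤ P i := fun i => by
          rcases eq_or_ne i c with rfl | hi
          · have := hQ i
            rw [Function.update_self]; omega
          · rw [Function.update_of_ne hi]; exact hQ i
        simp only [val_pure]
        rw [ih (le_of_step hs h) hQ', Finset.card_filter]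
        simp [hc]

open Classical in
/-- `smallerWords` counts the words `y` for which `y y y …` has a factor smaller than `w`. The
number of loops of the automaton is summed over the words first, and over the states second. -/
theorem smallerWords_val [NeZero q] {P : Fin q → ℕ} {w : List (Fin q)} {d : ℕ}
    (hd : w.length = d * ∑ i, P i) (hw : w ≠ []) :
    (smallerWords P w).val = ((contentWords P).filter fun y =>
      ∃ i, window (periodic y) i w.length < w).card := by
  have hU : ∀ s₀ ∈ Finset.range (w.length + 1),
      (pathTable P w s₀ (∑ i, P i)).val (s₀, P) =
        ∑ y ∈ contentWords P, if run w s₀ y = some s₀ then 1 else 0 := fun s₀ hs₀ => by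
    rw [pathTable_val _ _ (Nat.lt_succ_iff.1 (Finset.mem_range.1 hs₀)) fun _ => le_rfl,
      ← Finset.filter_filter, Finset.card_filter]
    rfl
  have hval : (smallerWords P w).val = Nat.multinomial Finset.univ P -
      ∑ s₀ ∈ Finset.range (w.length + 1), (pathTable P w s₀ (∑ i, P i)).val (s₀, P) := by
    simp only [smallerWords, val_bind, val_sumList, val_pure]
    rfl
  rw [hval, Finset.sum_congr rfl hU, Finset.sum_comm, ← card_contentWords]
  have hy : ∀ y ∈ contentWords P,
      (∑ s₀ ∈ Finset.range (w.length + 1), if run w s₀ y = some s₀ then 1 else 0) =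
        if ¬ ∃ i, window (periodic y) i w.length < w then 1 else 0 := fun y hy => by
    rw [← Finset.card_filter,
      card_loops (hd.trans (by rw [(mem_contentWords.1 hy).length_eq])) hw, ite_not]
  rw [Finset.sum_congr rfl hy, ← Finset.card_filter,
    ← Finset.card_filter_add_card_filter_not (s := contentWords P)
      (fun y => ∃ i, window (periodic y) i w.length < w), Nat.add_sub_cancel]

end Tables

/-! ### Orbits of rotations -/

section Rotations

variable {α : Type}

theorem rotate_mul_eq_self {x : List α} {i : ℕ} (h : x.rotate i = x) (m : ℕ) :
    x.rotate (i * m) = x := by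
  induction m with
  | zero => simp
  | succ m ih => rw [mul_add, mul_one, ← List.rotate_rotate, ih, h]

theorem rotate_gcd_eq_self_iff (x : List α) (i : ℕ) :
    x.rotate (x.length.gcd i) = x ↔ x.rotate i = x := by
  constructor
  · intro h
    obtain ⟨m, hm⟩ := Nat.gcd_dvd_right x.length i
    rw [hm]
    exact rotate_mul_eq_self h m
  · intro h
    rcases Nat.eq_zero_or_pos x.length with h0 | h0
    · simp [List.length_eq_zero_iff.1 h0]
    rcases (Nat.le_of_dvd h0 (Nat.gcd_dvd_right i x.length)).lt_or_eq with hlt | heq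
    · obtain ⟨m, -, hm⟩ := Nat.exists_mul_mod_eq_gcd hlt
      rw [Nat.gcd_comm, ← hm, List.rotate_mod, rotate_mul_eq_self h]
    · rw [Nat.gcd_comm, heq, List.rotate_length]

theorem rotate_sub_rotate {x : List α} {i : ℕ} (h : i ≤ x.length) :
    (x.rotate i).rotate (x.length - i) = x := by
  rw [List.rotate_rotate, Nat.add_sub_cancel' h, List.rotate_length]

theorem rotate_sub_mod_rotate (x : List α) (i : ℕ) :
    (x.rotate i).rotate (x.length - i % x.length) = x := by
  rcases Nat.eq_zero_or_pos x.length with h0 | h0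
  · simp [List.length_eq_zero_iff.1 h0]
  · rw [← List.rotate_mod x i, rotate_sub_rotate (Nat.mod_lt _ h0).le]

/-- A word has as many rotations onto itself as its rotations have onto it. -/
theorem card_rotate_eq [DecidableEq α] {n x : List α} {k : ℕ} (hk : n.rotate k = x)
    (hx : x ≠ []) :
    ((Finset.range x.length).filter fun i => x.rotate i = x).card =
      ((Finset.range x.length).filter fun i => n.rotate i = x).card := by
  have hl : 0 < x.length := List.length_pos_iff.2 hx
  have hnl : n.length = x.length := by rw [← hk, List.length_rotate]
  set l := x.length with hlx
  set k' := k % l with hk'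
  have hk'l : k' < l := Nat.mod_lt _ hl
  have hkx : n.rotate k' = x := by rw [hk', ← hnl, List.rotate_mod, hk]
  refine Finset.card_nbij' (fun i => (k' + i) % l) (fun i => (i + (l - k')) % l) ?_ ?_ ?_ ?_
  · intro i hi
    simp only [Finset.coe_filter, Finset.mem_range, Set.mem_ofPred_eq] at hi ⊢
    refine ⟨Nat.mod_lt _ hl, ?_⟩
    rw [← hnl, List.rotate_mod, ← List.rotate_rotate, hkx, hi.2]
  · intro i hi
    simp only [Finset.coe_filter, Finset.mem_range, Set.mem_ofPred_eq] at hi ⊢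
    refine ⟨Nat.mod_lt _ hl, ?_⟩
    conv_lhs => rw [← hkx]
    rw [List.rotate_rotate, ← hnl, ← List.rotate_mod, Nat.add_mod_mod,
      show k' + (i + (n.length - k')) = i + n.length by omega, Nat.add_mod_right, List.rotate_mod,
      hi.2]
  · intro i hi
    simp only [Finset.coe_filter, Finset.mem_range, Set.mem_ofPred_eq] at hi
    show ((k' + i) % l + (l - k')) % l = i
    rw [Nat.mod_add_mod, show k' + i + (l - k') = i + l by omega, Nat.add_mod_right,
      Nat.mod_eq_of_lt hi.1]
  · intro i hi
    simp only [Finset.coe_filter, Finset.mem_range, Set.mem_ofPred_eq] at hi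
    show (k' + (i + (l - k')) % l) % l = i
    rw [Nat.add_mod_mod, show k' + (i + (l - k')) = i + l by omega, Nat.add_mod_right,
      Nat.mod_eq_of_lt hi.1]

variable [LinearOrder α]

theorem IsNecklace.le_rotate {x : List α} (h : IsNecklace x) (i : ℕ) : x ≤ x.rotate i := by
  rcases Nat.eq_zero_or_pos x.length with h0 | h0
  · simp [List.length_eq_zero_iff.1 h0]
  · rw [← List.rotate_mod]
    exact h _ (Nat.mod_lt _ h0)

theorem IsNecklace.eq_of_rotate {x y : List α} (hx : IsNecklace x) (hy : IsNecklace y) {i : ℕ}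
    (h : x.rotate i = y) : x = y := by
  refine le_antisymm (h ▸ hx.le_rotate i) ?_
  have : (y.rotate (x.length - i % x.length)) = x := by rw [← h, rotate_sub_mod_rotate]
  exact this ▸ hy.le_rotate _

theorem exists_isNecklace_rotate (x : List α) : ∃ i, IsNecklace (x.rotate i) := by
  rcases Nat.eq_zero_or_pos x.length with h0 | h0
  · exact ⟨0, by simp [IsNecklace, List.length_eq_zero_iff.1 h0]⟩
  · obtain ⟨i, -, hi⟩ := Finset.exists_min_image (Finset.range x.length) (fun i => x.rotate i)
      ⟨0, Finset.mem_range.2 h0⟩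
    refine ⟨i, fun j _ => ?_⟩
    rw [List.rotate_rotate, ← List.rotate_mod x (i + j)]
    exact hi _ (Finset.mem_range.2 (Nat.mod_lt _ h0))

end Rotations

/-! ### Ranks by orbit counting -/

section Rank

variable {q : ℕ}

open Classical in
/-- Orbit counting: fixed points of rotations among the words with a rotation below `w`. -/
theorem sum_card_rotate_eq_self {P : Fin q → ℕ} (w : List (Fin q)) (hP : ∑ i, P i ≠ 0) :
    ∑ i ∈ Finset.range (∑ i, P i),
      ((contentWords P).filter fun x => (∃ r, x.rotate r < w) ∧ x.rotate i = x).card =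
      (∑ i, P i) * ((contentWords P).filter fun x => IsNecklace x ∧ x < w).card := by
  set l := ∑ i, P i with hl
  set X := (contentWords P).filter fun x => ∃ r, x.rotate r < w with hX
  set N := (contentWords P).filter fun x => IsNecklace x ∧ x < w with hN
  have hlen : ∀ x ∈ X, x.length = l := fun x hx =>
    (mem_contentWords.1 (Finset.mem_filter.1 hx).1).length_eq
  calc ∑ i ∈ Finset.range l,
        ((contentWords P).filter fun x => (∃ r, x.rotate r < w) ∧ x.rotate i = x).card
      = ∑ x ∈ X, ((Finset.range l).filter fun i => x.rotate i = x).card := by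
        simp only [← Finset.filter_filter, ← hX, Finset.card_filter _ X]
        rw [Finset.sum_comm]
        simp only [Finset.card_filter]
    _ = ∑ x ∈ X, ∑ n ∈ N, ((Finset.range l).filter fun i => n.rotate i = x).card := by
        refine Finset.sum_congr rfl fun x hx => ?_
        obtain ⟨i, hi⟩ := exists_isNecklace_rotate x
        have hxl := hlen x hx
        have hx0 : x ≠ [] := by rintro rfl; exact hP (by simpa using hxl.symm)
        have hx' := Finset.mem_filter.1 hx
        have hix := rotate_sub_mod_rotate x i
        have hmem : x.rotate i ∈ N := by
          refine Finset.mem_filter.2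
            ⟨mem_contentWords.2 ((mem_contentWords.1 hx'.1).rotate i), hi, ?_⟩
          obtain ⟨r, hr⟩ := hx'.2
          refine lt_of_le_of_lt ?_ hr
          have := hi.le_rotate (x.length - i % x.length + r)
          rwa [← List.rotate_rotate, hix] at this
        rw [Finset.sum_eq_single_of_mem _ hmem, ← hxl, card_rotate_eq hix hx0]
        intro n hn hne
        rw [Finset.card_eq_zero, Finset.filter_eq_empty_iff]
        intro j _ hj
        exact hne ((Finset.mem_filter.1 hn).2.1.eq_of_rotate hi (i := j + i)
          (by rw [← List.rotate_rotate, hj]))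
    _ = ∑ n ∈ N, ∑ i ∈ Finset.range l, ∑ x ∈ X, if n.rotate i = x then 1 else 0 := by
        rw [Finset.sum_comm]
        refine Finset.sum_congr rfl fun n _ => ?_
        rw [Finset.sum_comm]
        simp only [Finset.card_filter]
    _ = ∑ n ∈ N, l := by
        refine Finset.sum_congr rfl fun n hn => ?_
        have h1 : ∀ i ∈ Finset.range l, (∑ x ∈ X, if n.rotate i = x then 1 else 0) = 1 := by
          intro i hi
          rw [Finset.sum_ite_eq, if_pos]
          have hn' := Finset.mem_filter.1 hn
          have hnl := (mem_contentWords.1 hn'.1).length_eq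
          refine Finset.mem_filter.2 ⟨mem_contentWords.2 ((mem_contentWords.1 hn'.1).rotate i),
            n.length - i, ?_⟩
          rw [rotate_sub_rotate (by rw [hnl]; exact (Finset.mem_range.1 hi).le)]
          exact hn'.2.2
        rw [Finset.sum_congr rfl h1]
        simp
    _ = l * N.card := by rw [Finset.sum_const, smul_eq_mul, mul_comm]

theorem count_power (y : List (Fin q)) (d : ℕ) (c : Fin q) :
    (power y d).count c = d * y.count c := by
  induction d with
  | zero => simp [power]
  | succ d ih => rw [power_succ, List.count_append, ih]; ring

variable [NeZero q]

theorem power_take_of_rotate_eq_self {x : List (Fin q)} {d n : ℕ} (hx : x.length = d * n)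
    (h : x.rotate n = x) : power (x.take n) d = x := by
  rcases Nat.eq_zero_or_pos x.length with h0 | h0
  · obtain rfl := List.length_eq_zero_iff.1 h0
    simp [power]
  have hd : 0 < d := Nat.pos_of_mul_pos_right (hx ▸ h0)
  have hn : 0 < n := Nat.pos_of_mul_pos_left (hx ▸ h0)
  have hnx : n ≤ x.length := by rw [hx]; exact Nat.le_mul_of_pos_left n hd
  have hper : Function.Periodic (periodic x) n := fun p => by
    have h1 : window (periodic x) n x.length = window (periodic x) 0 x.length := by
      rw [window_periodic_length, window_periodic_length, h, List.rotate_zero]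
    have h2 : p % x.length < x.length := Nat.mod_lt _ h0
    have h3 := List.getElem_of_eq h1 (i := p % x.length) (by simpa using h2)
    rw [getElem_window, getElem_window, zero_add, periodic_mod] at h3
    rw [← h3]
    refine periodic_congr ?_
    rw [add_comm]
    exact ((Nat.mod_modEq _ _).symm).add_left _
  have hl : (x.take n).length = n := by simpa using hnx
  have hz := window_periodic_length x 0
  rw [List.rotate_zero] at hz
  rw [← window_periodic_zero, hl, ← hx]
  conv_rhs => rw [← hz]
  refine List.map_congr_left fun p _ => ?_
  rw [zero_add, ← hper.map_mod_nat p, periodic, hl,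
    periodic, Nat.mod_eq_of_lt (((Nat.mod_lt p hn).trans_le hnx))]
  have := Nat.mod_lt p hn
  rw [List.getD_eq_getElem _ _ (by omega), List.getD_eq_getElem _ _ (by omega), List.getElem_take]

open Classical in
/-- The words of period `ℓ / d` are the powers of words with Parikh vector `P / d`. -/
theorem card_rotate_eq_self {P : Fin q → ℕ} {w : List (Fin q)} (hw : w.length = ∑ i, P i)
    {d : ℕ} (hd : d ∣ ∑ i, P i) (hP : ∑ i, P i ≠ 0) :
    ((contentWords P).filter fun x =>
      (∃ r, x.rotate r < w) ∧ x.rotate ((∑ i, P i) / d) = x).card =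
    if ∀ i, d ∣ P i then
      ((contentWords fun i => P i / d).filter fun y =>
        ∃ i, window (periodic y) i w.length < w).card
    else 0 := by
  obtain ⟨n, hn⟩ := hd
  have hd0 : 0 < d := Nat.pos_of_ne_zero fun h => hP (by rw [hn, h, zero_mul])
  rw [hn, Nat.mul_div_cancel_left n hd0]
  have hcontent : ∀ x, HasContent P x → x.rotate n = x → ∀ i, P i = d * (x.take n).count i := by
    intro x hx hr i
    rw [← count_power, power_take_of_rotate_eq_self (hx.length_eq.trans hn) hr, hx i]
  split_ifs with hdvd
  · symm
    refine Finset.card_nbij' (fun y => power y d) (fun x => x.take n) ?_ ?_ ?_ ?_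
    · intro y hy
      simp only [Finset.coe_filter, mem_contentWords, Set.mem_ofPred_eq] at hy ⊢
      have hc : HasContent P (power y d) := fun i => by
        rw [count_power, hy.1 i, Nat.mul_div_cancel' (hdvd i)]
      have hpl : (power y d).length = w.length := hc.length_eq.trans hw.symm
      have hyl : y.length = n := by
        refine Nat.eq_of_mul_eq_mul_left hd0 ?_
        rw [← length_power, hpl, hw, hn]
      refine ⟨hc, ?_, ?_⟩
      · obtain ⟨r, hr⟩ := hy.2
        exact ⟨r, by rwa [← window_periodic_length, periodic_power y hd0.ne', hpl]⟩
      · rw [← window_periodic_length, periodic_power y hd0.ne', length_power,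
          ← window_periodic_zero]
        exact window_periodic_congr (by simp [hyl, Nat.ModEq]) _
    · intro x hx
      simp only [Finset.coe_filter, mem_contentWords, Set.mem_ofPred_eq] at hx ⊢
      have hpow := power_take_of_rotate_eq_self (hx.1.length_eq.trans hn) hx.2.2
      refine ⟨fun i => ?_, ?_⟩
      · show (x.take n).count i = P i / d
        rw [hcontent x hx.1 hx.2.2 i, Nat.mul_div_cancel_left _ hd0]
      · obtain ⟨r, hr⟩ := hx.2.1
        refine ⟨r, ?_⟩
        rwa [← periodic_power _ hd0.ne', hpow, hw, ← hx.1.length_eq, window_periodic_length]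
    · intro y hy
      simp only [Finset.coe_filter, mem_contentWords, Set.mem_ofPred_eq] at hy
      have hyl : y.length = n := by
        rw [hy.1.length_eq]
        refine Nat.eq_of_mul_eq_mul_left hd0 ?_
        rw [← hn, Finset.mul_sum]
        exact Finset.sum_congr rfl fun i _ => Nat.mul_div_cancel' (hdvd i)
      obtain ⟨d, rfl⟩ := Nat.exists_eq_succ_of_ne_zero hd0.ne'
      show (power y (d + 1)).take n = y
      rw [power_succ, List.take_left' hyl]
    · intro x hx
      simp only [Finset.coe_filter, mem_contentWords, Set.mem_ofPred_eq] at hx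
      exact power_take_of_rotate_eq_self (hx.1.length_eq.trans hn) hx.2.2
  · rw [Finset.card_eq_zero, Finset.filter_eq_empty_iff]
    rintro x hx ⟨-, hr⟩
    exact hdvd fun i => ⟨_, hcontent x (mem_contentWords.1 hx) hr i⟩

open Classical in
/-- The number of rotations `i < ℓ` with `gcd ℓ i = ℓ / d` is `φ(d)`, and each fixes the words of
period `ℓ / d`, so `rank` averages the numbers of fixed points over all rotations. -/
theorem rank_val {P : Fin q → ℕ} {w : List (Fin q)} (hw : w.length = ∑ i, P i)
    (hP : ∑ i, P i ≠ 0) :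
    (rank P w).val = ((contentWords P).filter fun x => IsNecklace x ∧ x < w).card := by
  set l := ∑ i, P i with hl
  have hw0 : w ≠ [] := by rintro rfl; exact hP (by simpa using hw.symm)
  have hval : (rank P w).val = (∑ d ∈ Finset.range l, if ∀ i, (d + 1) ∣ P i then
      (d + 1).totient * (smallerWords (fun i => P i / (d + 1)) w).val else 0) / l := by
    have : ∀ f : ℕ → ℕ, ∑ d ∈ Finset.range l, f (d + 1) =
        (((List.range l).map (· + 1)).map f).sum := fun f => by
      rw [List.map_map]; rfl
    rw [this fun d => if ∀ i, d ∣ P i then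
      d.totient * (smallerWords (fun i => P i / d) w).val else 0]
    simp only [rank, val_bind, val_sumList, val_pure]
    congr 3
    funext d
    split_ifs <;> rfl
  set F : ℕ → ℕ := fun e =>
    ((contentWords P).filter fun x => (∃ r, x.rotate r < w) ∧ x.rotate e = x).card with hF
  have hterm : ∀ d, d ∣ l → (if ∀ i, d ∣ P i then
      d.totient * (smallerWords (fun i => P i / d) w).val else 0) = d.totient * F (l / d) := by
    intro d hd
    have := card_rotate_eq_self hw hd hP
    rw [show F (l / d) = _ from this]
    split_ifs with h
    · rw [smallerWords_val (d := d) _ hw0]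
      rw [hw, hl, Finset.mul_sum]
      exact Finset.sum_congr rfl fun i _ => (Nat.mul_div_cancel' (h i)).symm
    · rw [mul_zero]
  have hsum : (∑ d ∈ Finset.range l, if ∀ i, (d + 1) ∣ P i then
      (d + 1).totient * (smallerWords (fun i => P i / (d + 1)) w).val else 0) =
      ∑ d ∈ l.divisors, d.totient * F (l / d) := by
    rw [← Finset.sum_congr rfl fun d hd => hterm d (Nat.dvd_of_mem_divisors hd)]
    rw [Nat.divisors, Finset.sum_filter_of_ne, Finset.sum_Ico_eq_sum_range]
    · simp only [Nat.add_sub_cancel, add_comm 1]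
    · intro d _ hd
      by_contra h
      refine hd (if_neg fun h' => h ?_)
      exact Finset.dvd_sum fun i _ => h' i
  have hgcd : ∑ i ∈ Finset.range l, F i = ∑ d ∈ l.divisors, d.totient * F (l / d) := by
    have h1 : ∀ i, F i = F (l.gcd i) := fun i => by
      refine congrArg Finset.card (Finset.filter_congr fun x hx => ?_)
      rw [hl, ← (mem_contentWords.1 hx).length_eq, rotate_gcd_eq_self_iff]
    rw [← Nat.sum_div_divisors]
    have h2 : ∀ e ∈ l.divisors, (l / e).totient * F (l / (l / e)) =
        ∑ i ∈ (Finset.range l).filter (fun i => l.gcd i = e), F i := fun e he => by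
      rw [Nat.totient_div_of_dvd (Nat.dvd_of_mem_divisors he),
        Nat.div_div_self (Nat.dvd_of_mem_divisors he) hP, ← smul_eq_mul, ← Finset.sum_const]
      refine Finset.sum_congr rfl fun i hi => ?_
      rw [h1 i, (Finset.mem_filter.1 hi).2]
    rw [Finset.sum_congr rfl h2]
    exact (Finset.sum_fiberwise_of_maps_to (fun i _ =>
      Nat.mem_divisors.2 ⟨Nat.gcd_dvd_left _ _, hP⟩) _).symm
  rw [hval, hsum, ← hgcd, sum_card_rotate_eq_self w hP, Nat.mul_div_cancel_left _
    (Nat.pos_of_ne_zero hP)]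

end Rank

/-! ### Prefixes of necklaces -/

section Prefix

variable {q : ℕ}

/-- `p` is a prefix of a necklace with Parikh vector `P`. -/
def IsNecklacePrefix (P : Fin q → ℕ) (p : List (Fin q)) : Prop := ∃ x ∈ fixedContent P, p <+: x

theorem length_of_mem_fixedContent {P : Fin q → ℕ} {x : List (Fin q)} (hx : x ∈ fixedContent P) :
    x.length = ∑ i, P i := HasContent.length_eq hx.2

variable [NeZero q]

theorem replicate_zero_le (z : List (Fin q)) : List.replicate z.length 0 ≤ z := by
  induction z with
  | nil => simp
  | cons c z ih =>
    rw [List.length_cons, List.replicate_succ, ← not_lt, List.cons_lt_cons_iff]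
    rintro (h | ⟨-, h⟩)
    · exact absurd h (Fin.not_lt_zero c)
    · exact h.not_ge ih

theorem le_replicate_rev_zero (z : List (Fin q)) :
    z ≤ List.replicate z.length (Fin.rev (0 : Fin q)) := by
  induction z with
  | nil => simp
  | cons c z ih =>
    rw [List.length_cons, List.replicate_succ, ← not_lt, List.cons_lt_cons_iff]
    rintro (h | ⟨-, h⟩)
    · have := c.isLt
      simp only [Fin.lt_def, Fin.val_rev, Fin.val_zero] at h
      omega
    · exact h.not_ge ih

theorem append_le_append_left {α : Type} [LinearOrder α] (p : List α) {u v : List α} (h : u ≤ v) :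
    p ++ u ≤ p ++ v := by
  rcases h.lt_or_eq with h | rfl
  · exact (List.append_left_lt h).le
  · exact le_rfl

theorem prefix_iff_between {p x : List (Fin q)} (h : p.length ≤ x.length) :
    p <+: x ↔ p ++ List.replicate (x.length - p.length) 0 ≤ x ∧
      x ≤ p ++ List.replicate (x.length - p.length) (Fin.rev (0 : Fin q)) := by
  constructor
  · rintro ⟨z, rfl⟩
    rw [List.length_append, Nat.add_sub_cancel_left]
    exact ⟨append_le_append_left p (replicate_zero_le z),
      append_le_append_left p (le_replicate_rev_zero z)⟩
  · rintro ⟨h1, h2⟩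
    have hle : ∀ {u v : List (Fin q)}, u ≤ v → u.take p.length ≤ v.take p.length := fun h =>
      h.lt_or_eq.elim (fun h => take_le_of_lt h _) fun h => h ▸ le_rfl
    have h3 := hle h1
    have h4 := hle h2
    rw [List.take_left' rfl] at h3 h4
    rw [h3.antisymm h4]
    exact List.take_prefix _ _

open Classical in
theorem prefixCount_pos {P : Fin q → ℕ} {p : List (Fin q)} (hp : p.length ≤ ∑ i, P i)
    (hP : ∑ i, P i ≠ 0) : 0 < (prefixCount P p).val ↔ IsNecklacePrefix P p := by
  set l := ∑ i, P i with hl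
  set lo := p ++ List.replicate (l - p.length) (0 : Fin q) with hlo
  set hi := p ++ List.replicate (l - p.length) (Fin.rev (0 : Fin q)) with hhi
  have hlol : lo.length = l := by simp [hlo]; omega
  have hhil : hi.length = l := by simp [hhi]; omega
  have hval : (prefixCount P p).val = (rank P hi).val - (rank P lo).val +
      if IsNecklace hi ∧ HasContent P hi then 1 else 0 := by
    simp only [prefixCount, val_bind, val_pure]
    congr 1
  have hlohi : lo ≤ hi := by
    have := (prefix_iff_between (p := p) (x := hi) (by omega)).1 (List.prefix_append _ _)
    rw [hhil] at this
    exact this.1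
  rw [hval, rank_val hhil hP, rank_val hlol hP, ← Finset.card_sdiff_of_subset
    (Finset.monotone_filter_right _ fun x _ hx => ⟨hx.1, hx.2.trans_le hlohi⟩)]
  have hmem : ∀ x, HasContent P x → (p <+: x ↔ lo ≤ x ∧ x ≤ hi) := fun x hx => by
    have := prefix_iff_between (p := p) (x := x) (hx.length_eq ▸ hp)
    rwa [hx.length_eq] at this
  constructor
  · intro h
    split_ifs at h with hc
    · exact ⟨hi, hc, List.prefix_append _ _⟩
    · obtain ⟨x, hx⟩ := Finset.card_pos.1 h
      simp only [Finset.mem_sdiff, Finset.mem_filter, mem_contentWords, not_and, not_lt] at hx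
      exact ⟨x, ⟨hx.1.2.1, hx.1.1⟩, (hmem x hx.1.1).2 ⟨hx.2 hx.1.1 hx.1.2.1, hx.1.2.2.le⟩⟩
  · rintro ⟨x, hx, hpx⟩
    have h := (hmem x hx.2).1 hpx
    rcases h.2.lt_or_eq with hlt | rfl
    · refine Nat.add_pos_left (Finset.card_pos.2 ⟨x, ?_⟩) _
      simp only [Finset.mem_sdiff, Finset.mem_filter, mem_contentWords, not_and, not_lt]
      exact ⟨⟨hx.2, hx.1, hlt⟩, fun _ _ => h.1⟩
    · rw [if_pos (show IsNecklace hi ∧ HasContent P hi from hx)]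
      exact Nat.succ_pos _

end Prefix

/-! ### Correctness of the prefix tree -/

section Tree

variable {q : ℕ} {P : Fin q → ℕ}

/-- `ps` lists the prefixes of length `t` of the necklaces with Parikh vector `P`. -/
def IsLevel (P : Fin q → ℕ) (t : ℕ) (ps : List (List (Fin q))) : Prop :=
  ps.Nodup ∧ ∀ p, p ∈ ps ↔ p.length = t ∧ IsNecklacePrefix P p

theorem isLevel_zero (h : (fixedContent P).Nonempty) : IsLevel P 0 [[]] := by
  refine ⟨List.nodup_singleton _, fun p => ?_⟩
  rw [List.mem_singleton, List.length_eq_zero_iff]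
  obtain ⟨x, hx⟩ := h
  exact ⟨fun hp => ⟨hp, x, hx, hp ▸ List.nil_prefix⟩, And.left⟩

theorem coe_toFinset_of_isLevel {ps : List (List (Fin q))} (h : IsLevel P (∑ i, P i) ps) :
    (ps.toFinset : Set (List (Fin q))) = fixedContent P := by
  ext p
  rw [List.coe_toFinset, Set.mem_ofPred_eq, h.2]
  constructor
  · rintro ⟨hp, x, hx, hpx⟩
    rwa [hpx.eq_of_length (hp.trans (length_of_mem_fixedContent hx).symm)]
  · exact fun hp => ⟨length_of_mem_fixedContent hp, p, hp, List.prefix_refl p⟩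

variable [NeZero q]

theorem mem_children {p x : List (Fin q)} (hp : p.length < ∑ i, P i) :
    x ∈ (children P p).val ↔ (∃ c, x = p ++ [c]) ∧ IsNecklacePrefix P x := by
  have hval : (children P p).val = ((List.finRange q).map fun c => p ++ [c]).filter fun x =>
      decide (0 < (prefixCount P x).val) := by
    rw [children, val_filterList]; rfl
  rw [hval, List.mem_filter, List.mem_map, decide_eq_true_iff]
  constructor
  · rintro ⟨⟨c, -, rfl⟩, h⟩
    exact ⟨⟨c, rfl⟩, (prefixCount_pos (by simp; omega) (by omega)).1 h⟩
  · rintro ⟨⟨c, rfl⟩, h⟩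
    exact ⟨⟨c, List.mem_finRange c, rfl⟩, (prefixCount_pos (by simp; omega) (by omega)).2 h⟩

theorem nodup_children (p : List (Fin q)) : (children P p).val.Nodup := by
  rw [children, val_filterList]
  refine List.Nodup.filter _ (List.Nodup.map (fun c d h => ?_) (List.nodup_finRange q))
  simpa using h

/-- The sample of `grow` is taken from a rearrangement of the next level. -/
theorem perm_flatten {α : Type} (l : List (List α)) :
    (l.flatMap (fun g => g.take 1) ++ l.flatMap List.tail).Perm l.flatten := by
  induction l with
  | nil => simp
  | cons g l ih =>
    have hg : g.take 1 ++ g.tail = g := by cases g <;> simp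
    simp only [List.flatMap_cons, List.flatten_cons]
    refine List.Perm.trans ?_ (ih.append_left g)
    conv_rhs => rw [← hg]
    simp only [List.append_assoc]
    refine List.Perm.append_left _ ?_
    rw [← List.append_assoc, ← List.append_assoc]
    exact List.perm_append_comm.append_right _

theorem IsLevel.next {t : ℕ} {ps : List (List (Fin q))} (h : IsLevel P t ps)
    (ht : t < ∑ i, P i) : IsLevel P (t + 1) (ps.map fun p => (children P p).val).flatten := by
  have hlt : ∀ p ∈ ps, p.length < ∑ i, P i := fun p hp => by rwa [((h.2 p).1 hp).1]
  constructor
  · rw [List.nodup_flatten]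
    constructor
    · simp only [List.mem_map]
      rintro _ ⟨p, -, rfl⟩
      exact nodup_children p
    · rw [List.pairwise_map]
      refine List.Pairwise.imp_of_mem (fun {p p'} hp hp' hne => ?_) h.1
      rw [List.disjoint_left]
      intro x hx hx'
      obtain ⟨⟨c, rfl⟩, -⟩ := (mem_children (hlt p hp)).1 hx
      obtain ⟨⟨c', hc'⟩, -⟩ := (mem_children (hlt p' hp')).1 hx'
      exact hne (List.append_inj_left' hc' rfl)
  · intro x
    simp only [List.mem_flatten, List.mem_map, exists_exists_and_eq_and]
    constructor
    · rintro ⟨p, hp, hx⟩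
      obtain ⟨⟨c, rfl⟩, h'⟩ := (mem_children (hlt p hp)).1 hx
      exact ⟨by simp [((h.2 p).1 hp).1], h'⟩
    · rintro ⟨hx, h'⟩
      have hx0 : x ≠ [] := by rintro rfl; simp at hx
      have hp : x.dropLast ∈ ps := by
        rw [h.2]
        obtain ⟨y, hy, hxy⟩ := h'
        exact ⟨by simp [hx], y, hy, (List.dropLast_prefix x).trans hxy⟩
      exact ⟨x.dropLast, hp, (mem_children (hlt _ hp)).2
        ⟨⟨x.getLast hx0, (List.dropLast_append_getLast hx0).symm⟩, h'⟩⟩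

/-- Either the last level is reached, which lists all necklaces, or the sample consists of `k`
prefixes of a level with more than `k` prefixes. -/
theorem grow_val {k m t : ℕ} {ps : List (List (Fin q))} (hk : k ≤ (fixedContent P).ncard)
    (hps : IsLevel P t ps) (hlen : ps.length ≤ k) (hm : m + t = ∑ i, P i) :
    (grow P k m ps).val.Nodup ∧ (grow P k m ps).val.length = k ∧
      ∃ t' ≤ ∑ i, P i, ∀ p ∈ (grow P k m ps).val, p.length = t' ∧ IsNecklacePrefix P p := by
  induction m generalizing t ps with
  | zero =>
    rw [zero_add] at hm
    subst hm
    refine ⟨hps.1, le_antisymm hlen ?_, _, le_rfl, fun p hp => (hps.2 p).1 hp⟩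
    rw [← coe_toFinset_of_isLevel hps, Set.ncard_coe_finset,
      List.toFinset_card_of_nodup hps.1] at hk
    exact hk
  | succ m ih =>
    have hnext := hps.next (by omega)
    simp only [grow, val_bind, val_mapList]
    split_ifs with hle
    · exact ih hnext hle (by omega)
    · set gs := ps.map fun p => (children P p).val with hgs
      have hperm := perm_flatten gs
      simp only [val_pure]
      refine ⟨((hperm.nodup_iff.2 hnext.1).sublist (List.take_sublist _ _)), ?_, t + 1, by omega,
        fun p hp => (hnext.2 p).1 (hperm.mem_iff.1 (List.mem_of_mem_take hp))⟩
      rw [List.length_take, hperm.length_eq]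
      omega

theorem complete_val {m : ℕ} {p : List (Fin q)} (hm : m + p.length = ∑ i, P i)
    (hp : IsNecklacePrefix P p) :
    (complete P m p).val ∈ fixedContent P ∧ p <+: (complete P m p).val := by
  induction m generalizing p with
  | zero =>
    obtain ⟨x, hx, hpx⟩ := hp
    have : p = x := hpx.eq_of_length (by rw [length_of_mem_fixedContent hx]; omega)
    exact ⟨this ▸ hx, List.prefix_refl p⟩
  | succ m ih =>
    have hmem := fun x => mem_children (P := P) (p := p) (x := x) (by omega)
    simp only [complete, val_bind]
    cases h : (children P p).val with
    | nil =>
      obtain ⟨x, hx, z, rfl⟩ := hp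
      have hxl := length_of_mem_fixedContent hx
      cases z with
      | nil => simp at hxl; omega
      | cons c z =>
        have : p ++ [c] ∈ (children P p).val :=
          (hmem _).2 ⟨⟨c, rfl⟩, _, hx, by simp⟩
        simp [h] at this
    | cons x xs =>
      obtain ⟨⟨c, rfl⟩, hx⟩ := (hmem x).1 (h ▸ List.mem_cons_self)
      have := ih (p := p ++ [c]) (by simp; omega) hx
      exact ⟨this.1, (List.prefix_append _ _).trans this.2⟩

/-- The prefix-tree algorithm returns `k` distinct necklaces. -/
theorem prefixTreeCentres_val {k : ℕ} (hk : 1 ≤ k) (hkL : k ≤ (fixedContent P).ncard) :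
    ((prefixTreeCentres P k).val.toFinset : Set (List (Fin q))) ⊆ fixedContent P ∧
      (prefixTreeCentres P k).val.toFinset.card = k := by
  have hne : (fixedContent P).Nonempty := Set.nonempty_of_ncard_ne_zero (by omega)
  obtain ⟨hnd, hlen, t, ht, hmem⟩ :=
    grow_val (m := ∑ i, P i) hkL (isLevel_zero hne) (by simpa using hk) (add_zero _)
  have hval : (prefixTreeCentres P k).val = (grow P k (∑ i, P i) [[]]).val.map fun p =>
      (complete P (∑ i, P i - p.length) p).val := by
    simp only [prefixTreeCentres, val_bind, val_mapList]
  set ps := (grow P k (∑ i, P i) [[]]).val with hps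
  have hc : ∀ p ∈ ps, (complete P (∑ i, P i - p.length) p).val ∈ fixedContent P ∧
      p <+: (complete P (∑ i, P i - p.length) p).val := fun p hp =>
    complete_val (by rw [(hmem p hp).1]; omega) (hmem p hp).2
  rw [hval]
  constructor
  · intro x hx
    simp only [List.coe_toFinset, List.mem_map, Set.mem_ofPred_eq] at hx
    obtain ⟨p, hp, rfl⟩ := hx
    exact (hc p hp).1
  · rw [List.toFinset_card_of_nodup, List.length_map, hlen]
    refine List.Nodup.map_on (fun p hp p' hp' h => ?_) hnd
    have h1 := (hc p hp).2
    have h2 := (hc p' hp').2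
    rw [h] at h1
    exact (List.prefix_of_prefix_length_le h1 h2
      (by rw [(hmem p hp).1, (hmem p' hp').1])).eq_of_length
      (by rw [(hmem p hp).1, (hmem p' hp').1])

end Tree

/-! ### Cost of the elementary loops -/

section Costs

variable {α β : Type}

@[simp] theorem _root_.Timed.cost_pure (a : α) : (pure a : Timed α).cost = 0 := rfl

@[simp] theorem _root_.Timed.cost_tick (n : ℕ) : (tick n).cost = n := rfl

@[simp] theorem _root_.Timed.cost_bind (x : Timed α) (f : α → Timed β) :
    (x >>= f).cost = x.cost + (f x.val).cost := rfl

theorem _root_.Timed.cost_mapList_le {f : α → Timed β} {l : List α} {B : ℕ}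
    (h : ∀ a ∈ l, (f a).cost ≤ B) : (mapList f l).cost ≤ l.length * (B + 1) := by
  induction l with
  | nil => simp [mapList]
  | cons a l ih =>
    have h1 := h a List.mem_cons_self
    have h2 := ih fun b hb => h b (List.mem_cons_of_mem _ hb)
    simp only [mapList, cost_bind, cost_tick, cost_pure, List.length_cons, add_mul]
    omega

theorem _root_.Timed.cost_filterList_le {f : α → Timed Bool} {l : List α} {B : ℕ}
    (h : ∀ a ∈ l, (f a).cost ≤ B) : (filterList f l).cost ≤ l.length * (B + 1) := by
  induction l with
  | nil => simp [filterList]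
  | cons a l ih =>
    have h1 := h a List.mem_cons_self
    have h2 := ih fun b hb => h b (List.mem_cons_of_mem _ hb)
    simp only [filterList, cost_bind, cost_tick, cost_pure, List.length_cons, add_mul]
    omega

theorem _root_.Timed.cost_sumList_le {f : α → Timed ℕ} {l : List α} {B : ℕ}
    (h : ∀ a ∈ l, (f a).cost ≤ B) : (sumList f l).cost ≤ l.length * (B + 1) := by
  induction l with
  | nil => simp [sumList]
  | cons a l ih =>
    have h1 := h a List.mem_cons_self
    have h2 := ih fun b hb => h b (List.mem_cons_of_mem _ hb)
    simp only [sumList, cost_bind, cost_tick, cost_pure, List.length_cons, add_mul]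
    omega

theorem _root_.Timed.cost_table_le [DecidableEq α] {f : α → Timed ℕ} {l : List α} {B : ℕ}
    (h : ∀ a ∈ l, (f a).cost ≤ B) : (table f l).cost ≤ l.length * (B + 1) := by
  induction l with
  | nil => simp [table]
  | cons a l ih =>
    have h1 := h a List.mem_cons_self
    have h2 := ih fun b hb => h b (List.mem_cons_of_mem _ hb)
    simp only [table, cost_bind, cost_tick, cost_pure, List.length_cons, add_mul]
    omega

end Costs

/-! ### Cost of the prefix-tree algorithm -/

section TreeCost

/-- Bound for the cost of one table of the dynamic programming. -/
def tableCost (q l : ℕ) : ℕ :=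
  (l + 1) * (l + 1) ^ q * (q * (q + 1 + 2 * (l + 2) * (l + 2) + 1) + 1)

/-- Bound for the cost of `smallerWords`. -/
def smallerWordsCost (q l : ℕ) : ℕ :=
  2 * (l + q + 1) + (l + 1) * ((l + 1) * tableCost q l + 1)

/-- Bound for the cost of `rank`. -/
def rankCost (q l : ℕ) : ℕ := q + 1 + l * (q + l * l + smallerWordsCost q l + 1)

/-- Bound for the cost of `children`. -/
def childrenCost (q l : ℕ) : ℕ :=
  q * (l + 1 + (q + 2 * (l + 1) + (rankCost q l + (rankCost q l + (l + q) * (l + 1)))) + 1)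

/-- Bound for the cost of one level of `grow`. -/
def levelCost (q l k : ℕ) : ℕ := k * (childrenCost q l + 1) + (k + k * q + 1) * (l + 1)

theorem length_box_le : ∀ {q : ℕ} {P : Fin q → ℕ} {l : ℕ}, (∀ i, P i ≤ l) →
    (box P).length ≤ (l + 1) ^ q
  | 0, P, l, _ => by simp [box]
  | q + 1, P, l, h => by
    have ih := length_box_le (P := Fin.tail P) (l := l) fun i => h i.succ
    simp only [box, List.length_flatMap, List.length_map, List.map_const', List.sum_replicate,
      List.length_range, smul_eq_mul]
    rw [pow_succ']
    exact Nat.mul_le_mul (Nat.succ_le_succ (h 0)) ih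

variable {q : ℕ}

theorem length_tableIndices_le {P : Fin q → ℕ} {w : List (Fin q)} {l : ℕ} (hP : ∀ i, P i ≤ l)
    (hw : w.length ≤ l) :
    ((List.range (w.length + 1)).product (box P)).length ≤ (l + 1) * (l + 1) ^ q := by
  show (List.range (w.length + 1) ×ˢ box P).length ≤ _
  rw [List.length_product, List.length_range]
  exact Nat.mul_le_mul (Nat.succ_le_succ hw) (length_box_le hP)

theorem cost_pathTable_le {P : Fin q → ℕ} {w : List (Fin q)} {l : ℕ} (hP : ∀ i, P i ≤ l)
    (hw : w.length ≤ l) (hq : 0 < q) (s₀ m : ℕ) :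
    (pathTable P w s₀ m).cost ≤ (m + 1) * tableCost q l := by
  have hN := length_tableIndices_le hP hw
  induction m with
  | zero =>
    rw [pathTable, zero_add, one_mul]
    refine (cost_table_le (B := q + 1) fun x _ => ?_).trans ?_
    · simp
    · refine Nat.mul_le_mul hN (Nat.succ_le_succ ?_)
      exact le_trans (by omega) (Nat.le_mul_of_pos_left _ hq)
  | succ m ih =>
    rw [pathTable, cost_bind, add_mul _ 1, one_mul]
    refine Nat.add_le_add ih ((cost_table_le (B := q * (q + 1 + 2 * (l + 2) * (l + 2) + 1))
      fun x hx => ?_).trans (Nat.mul_le_mul_right _ hN))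
    have hs : x.1 ≤ l := by
      have := (List.mem_product.1 (show (x.1, x.2) ∈ _ from hx)).1
      rw [List.mem_range] at this
      omega
    have := cost_sumList_le (f := fun c => do
              tick (q + 1)
              if x.2 c = 0 then pure 0
              else
                match (← step w x.1 c) with
                | none => pure 0
                | some s => pure ((pathTable P w s₀ m).val (s, Function.update x.2 c (x.2 c - 1))))
            (l := List.finRange q) (B := q + 1 + 2 * (l + 2) * (l + 2)) fun c _ => by
      simp only [cost_bind, cost_tick]
      refine Nat.add_le_add_left ?_ _
      split_ifs
      · simp
      · have h1 : (step w x.1 c).cost = 2 * (x.1 + 2) * (x.1 + 2) := rfl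
        have h2 : 2 * (x.1 + 2) * (x.1 + 2) ≤ 2 * (l + 2) * (l + 2) := by gcongr
        rw [cost_bind, h1]
        cases (step w x.1 c).val <;> simpa using h2
    rwa [List.length_finRange] at this

theorem cost_smallerWords_le {P : Fin q → ℕ} {w : List (Fin q)} {l : ℕ} (hP : ∑ i, P i ≤ l)
    (hw : w.length ≤ l) (hq : 0 < q) : (smallerWords P w).cost ≤ smallerWordsCost q l := by
  have hP' : ∀ i, P i ≤ l := fun i =>
    (Finset.single_le_sum (fun _ _ => Nat.zero_le _) (Finset.mem_univ i)).trans hP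
  simp only [smallerWords, cost_bind, cost_tick, cost_pure, add_zero, smallerWordsCost]
  refine Nat.add_le_add (by omega) ((cost_sumList_le (B := (l + 1) * tableCost q l)
    fun s₀ _ => ?_).trans ?_)
  · simp only [cost_bind, cost_pure, add_zero]
    exact (cost_pathTable_le hP' hw hq _ _).trans (Nat.mul_le_mul_right _ (Nat.succ_le_succ hP))
  · rw [List.length_range]
    exact Nat.mul_le_mul_right _ (Nat.succ_le_succ hw)

theorem cost_rank_le {P : Fin q → ℕ} {w : List (Fin q)} (hw : w.length ≤ ∑ i, P i)
    (hq : 0 < q) : (rank P w).cost ≤ rankCost q (∑ i, P i) := by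
  set l := ∑ i, P i with hl
  simp only [rank, cost_bind, cost_tick, cost_pure, add_zero, rankCost, ← hl]
  refine Nat.add_le_add_left ((cost_sumList_le (B := q + l * l + smallerWordsCost q l)
    fun d hd => ?_).trans (by simp)) _
  have hdl : d ≤ l := by
    obtain ⟨e, he, rfl⟩ := List.mem_map.1 hd
    exact List.mem_range.1 he
  simp only [cost_bind, cost_tick]
  refine Nat.add_le_add (Nat.add_le_add_left (Nat.mul_le_mul hdl hdl) _) ?_
  split_ifs
  · simp only [cost_bind, cost_pure, add_zero]
    exact cost_smallerWords_le (Finset.sum_le_sum fun i _ => Nat.div_le_self _ _) hw hq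
  · simp

variable [NeZero q]

theorem cost_children_le {P : Fin q → ℕ} {p : List (Fin q)} (hp : p.length < ∑ i, P i) :
    (children P p).cost ≤ childrenCost q (∑ i, P i) := by
  have hq : 0 < q := Nat.pos_of_ne_zero (NeZero.ne q)
  rw [children, childrenCost]
  refine (cost_filterList_le (B := _) fun x hx => ?_).trans
    (by rw [List.length_map, List.length_finRange])
  obtain ⟨c, -, rfl⟩ := List.mem_map.1 hx
  simp only [cost_bind, cost_tick, cost_pure, add_zero, prefixCount]
  refine Nat.add_le_add (by omega) (Nat.add_le_add_left (Nat.add_le_add (cost_rank_le ?_ hq)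
    (Nat.add_le_add_right (cost_rank_le ?_ hq) _)) _) <;>
  · simp; omega

theorem length_children_le (P : Fin q → ℕ) (p : List (Fin q)) :
    (children P p).val.length ≤ q := by
  rw [children, val_filterList]
  exact (List.length_filter_le _ _).trans (by simp)

theorem length_flatten_le {α : Type} {gs : List (List α)} {B : ℕ} (h : ∀ g ∈ gs, g.length ≤ B) :
    gs.flatten.length ≤ gs.length * B := by
  rw [List.length_flatten]
  simpa using List.sum_le_card_nsmul (gs.map List.length) B (by simpa using h)

theorem cost_grow_le {P : Fin q → ℕ} {k m : ℕ} {ps : List (List (Fin q))} (hk : ps.length ≤ k)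
    (hm : ∀ p ∈ ps, p.length + m ≤ ∑ i, P i) :
    (grow P k m ps).cost ≤ m * levelCost q (∑ i, P i) k ∧ (grow P k m ps).val.length ≤ k ∧
      ∀ p ∈ (grow P k m ps).val, p.length ≤ ∑ i, P i := by
  induction m generalizing ps with
  | zero => exact ⟨by simp [grow], hk, hm⟩
  | succ m ih =>
    set gs := ps.map fun p => (children P p).val with hgs
    have hlen : gs.flatten.length ≤ k * q := by
      refine (length_flatten_le (B := q) fun g hg => ?_).trans
        (Nat.mul_le_mul_right q (by simpa [hgs] using hk))
      obtain ⟨p, -, rfl⟩ := List.mem_map.1 hg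
      exact length_children_le P p
    have hmem : ∀ x ∈ gs.flatten, x.length + m ≤ ∑ i, P i := fun x hx => by
      obtain ⟨g, hg, hxg⟩ := List.mem_flatten.1 hx
      obtain ⟨p, hp, rfl⟩ := List.mem_map.1 hg
      have := hm p hp
      obtain ⟨⟨c, rfl⟩, -⟩ := (mem_children (by omega)).1 hxg
      simp only [List.length_append, List.length_singleton]
      omega
    have hchildren : (mapList (children P) ps).cost ≤ k * (childrenCost q (∑ i, P i) + 1) :=
      (cost_mapList_le fun p hp => cost_children_le (by have := hm p hp; omega)).trans
        (Nat.mul_le_mul_right _ hk)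
    have hlevel : (mapList (children P) ps).cost +
        (gs.length + gs.flatten.length + 1) * (∑ i, P i + 1) ≤ levelCost q (∑ i, P i) k := by
      refine Nat.add_le_add hchildren (Nat.mul_le_mul_right _ ?_)
      have : gs.length = ps.length := by simp [hgs]
      omega
    simp only [grow, val_bind, cost_bind, val_mapList, cost_tick, ← hgs]
    rw [add_mul m 1, one_mul]
    split_ifs with hle
    · obtain ⟨h1, h2⟩ := ih hle hmem
      exact ⟨by omega, h2⟩
    · refine ⟨by simp only [cost_pure]; omega, by simp, fun p hp => ?_⟩
      have := hmem p ((perm_flatten gs).mem_iff.1 (List.mem_of_mem_take hp))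
      omega

theorem cost_complete_le {P : Fin q → ℕ} {m : ℕ} {p : List (Fin q)}
    (hm : m + p.length ≤ ∑ i, P i) :
    (complete P m p).cost ≤ m * childrenCost q (∑ i, P i) := by
  induction m generalizing p with
  | zero => simp [complete]
  | succ m ih =>
    have hc := cost_children_le (P := P) (p := p) (by omega)
    simp only [complete, cost_bind]
    rw [add_mul, one_mul, add_comm]
    refine Nat.add_le_add ?_ hc
    cases h : (children P p).val with
    | nil => simp
    | cons x xs =>
      obtain ⟨⟨c, rfl⟩, -⟩ := (mem_children (by omega)).1 (h ▸ List.mem_cons_self)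
      exact ih (by simp; omega)

theorem cost_prefixTreeCentres_le (P : Fin q → ℕ) {k : ℕ} (hk : 1 ≤ k) :
    (prefixTreeCentres P k).cost ≤ q + 1 + ((∑ i, P i) * levelCost q (∑ i, P i) k +
      k * ((∑ i, P i) * childrenCost q (∑ i, P i) + 1)) := by
  obtain ⟨h1, h2, h3⟩ := cost_grow_le (P := P) (k := k) (m := ∑ i, P i) (ps := [[]])
    (by simpa using hk) (by simp)
  simp only [prefixTreeCentres, cost_bind, cost_tick]
  refine Nat.add_le_add_left (Nat.add_le_add h1 ((cost_mapList_le fun p hp => ?_).trans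
    (Nat.mul_le_mul_right _ h2))) _
  have := h3 p hp
  exact (cost_complete_le (by omega)).trans (Nat.mul_le_mul_right _ (Nat.sub_le _ _))

end TreeCost

/-! ### Polynomial bounds -/

section Polynomial

/-- A function of positive integers `k`, `ℓ` is bounded by a polynomial in `k ℓ`. -/
def PolyBounded (f : ℕ → ℕ → ℕ) : Prop :=
  ∃ A D : ℕ, ∀ k l, 1 ≤ k → 1 ≤ l → f k l ≤ A * (k * l) ^ D

theorem PolyBounded.const (c : ℕ) : PolyBounded fun _ _ => c :=
  ⟨c, 0, fun _ _ _ _ => by simp⟩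

theorem PolyBounded.left : PolyBounded fun k _ => k :=
  ⟨1, 1, fun k l _ hl => by simpa using Nat.le_mul_of_pos_right k hl⟩

theorem PolyBounded.right : PolyBounded fun _ l => l :=
  ⟨1, 1, fun k l hk _ => by simpa using Nat.le_mul_of_pos_left l hk⟩

theorem PolyBounded.add {f g : ℕ → ℕ → ℕ} (hf : PolyBounded f) (hg : PolyBounded g) :
    PolyBounded fun k l => f k l + g k l := by
  obtain ⟨A, D, h⟩ := hf
  obtain ⟨A', D', h'⟩ := hg
  refine ⟨A + A', D + D', fun k l hk hl => ?_⟩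
  have hkl : 0 < k * l := Nat.mul_pos hk hl
  rw [add_mul]
  exact Nat.add_le_add
    ((h k l hk hl).trans (Nat.mul_le_mul_left _ (Nat.pow_le_pow_right hkl (Nat.le_add_right _ _))))
    ((h' k l hk hl).trans (Nat.mul_le_mul_left _ (Nat.pow_le_pow_right hkl (Nat.le_add_left _ _))))

theorem PolyBounded.mul {f g : ℕ → ℕ → ℕ} (hf : PolyBounded f) (hg : PolyBounded g) :
    PolyBounded fun k l => f k l * g k l := by
  obtain ⟨A, D, h⟩ := hf
  obtain ⟨A', D', h'⟩ := hg
  refine ⟨A * A', D + D', fun k l hk hl => (Nat.mul_le_mul (h k l hk hl) (h' k l hk hl)).trans ?_⟩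
  rw [pow_add]
  exact (mul_mul_mul_comm _ _ _ _).le

theorem PolyBounded.pow {f : ℕ → ℕ → ℕ} (hf : PolyBounded f) (n : ℕ) :
    PolyBounded fun k l => f k l ^ n := by
  induction n with
  | zero => simpa using PolyBounded.const 1
  | succ n ih => simpa only [pow_succ] using ih.mul hf

theorem exists_cost_bound (q : ℕ) [NeZero q] : ∃ A D : ℕ, ∀ (P : Fin q → ℕ) (k : ℕ),
    1 ≤ ∑ i, P i → 1 ≤ k → (prefixTreeCentres P k).cost ≤ A * (k * ∑ i, P i) ^ D := by
  have c := PolyBounded.const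
  have l := PolyBounded.right
  have k := PolyBounded.left
  have htable : PolyBounded fun _ l => tableCost q l := by
    unfold tableCost
    exact ((l.add (c 1)).mul ((l.add (c 1)).pow q)).mul (((c q).mul ((((c q).add (c 1)).add
      (((c 2).mul (l.add (c 2))).mul (l.add (c 2)))).add (c 1))).add (c 1))
  have hsmaller : PolyBounded fun _ l => smallerWordsCost q l := by
    unfold smallerWordsCost
    exact ((c 2).mul ((l.add (c q)).add (c 1))).add
      ((l.add (c 1)).mul (((l.add (c 1)).mul htable).add (c 1)))
  have hrank : PolyBounded fun _ l => rankCost q l := by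
    unfold rankCost
    exact ((c q).add (c 1)).add (l.mul ((((c q).add (l.mul l)).add hsmaller).add (c 1)))
  have hchildren : PolyBounded fun _ l => childrenCost q l := by
    unfold childrenCost
    exact (c q).mul (((l.add (c 1)).add (((c q).add ((c 2).mul (l.add (c 1)))).add
      (hrank.add (hrank.add ((l.add (c q)).mul (l.add (c 1))))))).add (c 1))
  have hlevel : PolyBounded fun k l => levelCost q l k := by
    unfold levelCost
    exact (k.mul (hchildren.add (c 1))).add
      (((k.add (k.mul (c q))).add (c 1)).mul (l.add (c 1)))
  obtain ⟨A, D, h⟩ := ((c q).add (c 1)).add ((l.mul hlevel).add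
    (k.mul ((l.mul hchildren).add (c 1))))
  exact ⟨A, D, fun P k hP hk => (cost_prefixTreeCentres_le P hk).trans (h k _ hk hP)⟩

end Polynomial

/-! ### Overlap of words of equal length -/

section Overlap

variable {α : Type}

theorem mem_subwords {w x : List α} :
    x ∈ subwords w ↔ ∃ j, 1 ≤ j ∧ j ≤ w.length ∧ ∃ i < w.length, (w.rotate i).take j = x := by
  simp [subwords, Multiset.mem_sum, and_assoc]

theorem card_subwords (w : List α) : (subwords w).card = w.length * w.length := by
  simp [subwords]

variable [DecidableEq α]

theorem overlapCoeff_eq {u v : List α} {l : ℕ} (hu : u.length = l) (hv : v.length = l)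
    (hl : 0 < l) :
    overlapCoeff u v = ((subwords u ∩ subwords v).card : ℝ≥0∞) / (l * l : ℕ) := by
  simp only [overlapCoeff, hu, hv, Nat.lcm_self, Nat.div_self hl, power_one, card_subwords,
    min_self]

theorem overlapDist_le_inv (u v : List α) : overlapDist u v ≤ (overlapCoeff u v)⁻¹ := by
  unfold overlapDist
  split_ifs with h0 h1
  · simp [h0]
  · exact zero_le
  · rw [one_div]

theorem overlapDist_eq_inv {u v : List α} (h : overlapCoeff u v ≠ 1) :
    overlapDist u v = (overlapCoeff u v)⁻¹ := by
  unfold overlapDist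
  split_ifs with h0
  · simp [h0]
  · rw [one_div]

theorem overlapCoeff_le_one {u v : List α} {l : ℕ} (hu : u.length = l) (hv : v.length = l)
    (hl : 0 < l) : overlapCoeff u v ≤ 1 := by
  rw [overlapCoeff_eq hu hv hl]
  refine ENNReal.div_le_of_le_mul ?_
  rw [one_mul, Nat.cast_le, ← hu, ← card_subwords]
  exact Multiset.card_le_card (Multiset.inter_le_left)

theorem overlapDist_self {u : List α} (hu : u ≠ []) : overlapDist u u = 0 := by
  have hl : 0 < u.length := List.length_pos_iff.2 hu
  have : overlapCoeff u u = 1 := by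
    rw [overlapCoeff_eq rfl rfl hl, ← Multiset.inf_eq_inter, inf_idem, card_subwords]
    exact ENNReal.div_self (by simpa using hu) (ENNReal.natCast_ne_top _)
  simp [overlapDist, this]

/-- If all subwords agree, then so do the subwords of full length, which are the rotations. -/
theorem eq_of_overlapCoeff_eq_one {α : Type} [LinearOrder α] {u v : List α} {l : ℕ}
    (hu : u.length = l) (hv : v.length = l) (hl : 0 < l) (hun : IsNecklace u) (hvn : IsNecklace v)
    (h : overlapCoeff u v = 1) : u = v := by
  rw [overlapCoeff_eq hu hv hl,
    ENNReal.div_eq_one_iff (by positivity) (ENNReal.natCast_ne_top _), Nat.cast_inj] at h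
  have h1 : subwords u ∩ subwords v = subwords u :=
    Multiset.eq_of_le_of_card_le Multiset.inter_le_left (by rw [card_subwords, h, hu])
  have hmem : u ∈ subwords u ∩ subwords v := by
    rw [h1, mem_subwords]
    exact ⟨l, hl, hu.ge, 0, hu ▸ hl, by simp [hu]⟩
  obtain ⟨j, -, hj, i, -, hi⟩ := mem_subwords.1 (Multiset.mem_inter.1 hmem).2
  have hjl : j = l := by
    have := congrArg List.length hi
    simp only [List.length_take, List.length_rotate] at this
    omega
  rw [List.take_of_length_le (by simp; omega)] at hi
  exact (hvn.eq_of_rotate hun hi).symm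

/-- Words without a common cyclic subword of length `J` have only shorter subwords in common. -/
theorem card_inter_subwords_le {u v : List α} {l J : ℕ} (hu : u.length = l) (hv : v.length = l)
    (hJ : 1 ≤ J)
    (h : ∀ i < l, ∀ i' < l, (u.rotate i).take J ≠ (v.rotate i').take J) :
    (subwords u ∩ subwords v).card ≤ l * (J - 1) := by
  have hshort : ∀ x ∈ subwords u ∩ subwords v, x.length < J := by
    intro x hx
    obtain ⟨⟨j, hj, hjl, i, hi, rfl⟩, ⟨j', hj', hjl', i', hi', hx'⟩⟩ :=
      (Multiset.mem_inter.1 hx).imp mem_subwords.1 mem_subwords.1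
    by_contra hlen
    rw [List.length_take, List.length_rotate] at hlen
    refine h i (hu ▸ hi) i' (hv ▸ hi') ?_
    have h1 := congrArg List.length hx'
    simp only [List.length_take, List.length_rotate] at h1
    have h2 := congrArg (List.take J) hx'
    rw [List.take_take, List.take_take, min_eq_left (by omega), min_eq_left (by omega)] at h2
    exact h2.symm
  calc (subwords u ∩ subwords v).card
      = (subwords u ∩ subwords v).countP (fun x => x.length < J) := by
        rw [Multiset.countP_eq_card.2 hshort]
    _ ≤ (subwords u).countP (fun x => x.length < J) :=
        Multiset.countP_le_of_le _ Multiset.inter_le_left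
    _ = ∑ j ∈ Finset.Icc 1 l, if j < J then l else 0 := by
        rw [← Multiset.coe_countPAddMonoidHom, subwords, map_sum, hu]
        refine Finset.sum_congr rfl fun j hj => ?_
        have hjl := (Finset.mem_Icc.1 hj).2
        rw [Multiset.coe_countPAddMonoidHom, Multiset.countP_map]
        have : ∀ i, ((u.rotate i).take j).length = j := fun i => by simp; omega
        simp only [this]
        split_ifs with hjJ <;> simp [hjJ]
    _ ≤ ∑ j ∈ Finset.Icc 1 (J - 1), l := by
        rw [← Finset.sum_filter]
        refine Finset.sum_le_sum_of_subset fun j hj => ?_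
        simp only [Finset.mem_filter, Finset.mem_Icc] at hj ⊢
        omega
    _ = l * (J - 1) := by simp [mul_comm]

end Overlap

/-! ### Upper bound for distances -/

section Upper

variable {q : ℕ} [NeZero q]

theorem card_periodic_ne (u : List (Fin q)) (M : Fin q) (p : ℕ) :
    ((Finset.range u.length).filter fun i => periodic u (i + p) ≠ M).card =
      u.length - u.count M := by
  have h1 : ((Finset.range u.length).filter fun i => periodic u (i + p) = M).card = u.count M := by
    rw [← (List.rotate_perm u p).count_eq, ← window_periodic_length, window, List.count,
      List.countP_map, List.countP_eq_length_filter]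
    simp only [add_comm p]
    rfl
  have h2 := Finset.card_filter_add_card_filter_not (s := Finset.range u.length)
    (fun i => periodic u (i + p) = M)
  rw [Finset.card_range] at h2
  simp only [ne_eq]
  omega

/-- Each of the `m` positions with a letter other than `M` meets at most `j` windows of length
`j`; all other windows consist of copies of `M` only. -/
theorem le_count_replicate (u : List (Fin q)) (M : Fin q) {j : ℕ} (hj : j ≤ u.length) :
    u.length - (u.length - u.count M) * j ≤
      ((Multiset.range u.length).map fun i => (u.rotate i).take j).count (List.replicate j M) := by
  set m := u.length - u.count M with hm
  have hwin : ∀ i, (u.rotate i).take j = List.replicate j M ↔ ∀ p < j, periodic u (i + p) = M := by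
    intro i
    rw [← window_periodic_length, take_window _ _ hj, List.eq_replicate_iff]
    simp [window]
  have hbad : ((Finset.range u.length).filter fun i =>
      ¬ (u.rotate i).take j = List.replicate j M).card ≤ m * j := by
    calc _ ≤ ((Finset.range j).biUnion fun p =>
          (Finset.range u.length).filter fun i => periodic u (i + p) ≠ M).card := by
          refine Finset.card_le_card fun i hi => ?_
          rw [Finset.mem_filter, hwin] at hi
          push Not at hi
          obtain ⟨hi, p, hp, hne⟩ := hi
          exact Finset.mem_biUnion.2 ⟨p, Finset.mem_range.2 hp, Finset.mem_filter.2 ⟨hi, hne⟩⟩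
      _ ≤ ∑ p ∈ Finset.range j, m := by
          refine Finset.card_biUnion_le.trans (Finset.sum_le_sum fun p _ => ?_)
          exact (card_periodic_ne u M p).le
      _ = m * j := by simp [mul_comm]
  have hgood := Finset.card_filter_add_card_filter_not (s := Finset.range u.length)
    (fun i => (u.rotate i).take j = List.replicate j M)
  have hcount : ((Multiset.range u.length).map fun i => (u.rotate i).take j).count
      (List.replicate j M) =
      ((Finset.range u.length).filter fun i => (u.rotate i).take j = List.replicate j M).card := by
    rw [Multiset.count_map]
    simp only [eq_comm (a := List.replicate j M)]
    rfl
  rw [Finset.card_range] at hgood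
  omega

theorem sum_replicate_le_subwords (u : List (Fin q)) (M : Fin q) :
    ∑ j ∈ Finset.Icc 1 u.length, Multiset.replicate (u.length - (u.length - u.count M) * j)
      (List.replicate j M) ≤ subwords u :=
  Finset.sum_le_sum fun _ hj =>
    Multiset.le_count_iff_replicate_le.1 (le_count_replicate u M (Finset.mem_Icc.1 hj).2)

/-- The terms with `2 m j ≤ l` are at least `l / 2`; if there are none, the term `j = 1` is at least
`l / q`. -/
theorem sq_le_sum {q l m : ℕ} (hm : 1 ≤ m) (hml : m ≤ l) (hq : l ≤ q * (l - m)) :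
    l * l ≤ 8 * q * m * ∑ j ∈ Finset.Icc 1 l, (l - m * j) := by
  have hq0 : 1 ≤ q := by
    rcases Nat.eq_zero_or_pos q with rfl | h
    · omega
    · exact h
  rcases le_or_gt (2 * m) l with h | h
  · set T := l / (2 * m) with hT
    have hT1 : 1 ≤ T := (Nat.one_le_div_iff (by omega)).2 h
    have hTl : 2 * m * T ≤ l := Nat.mul_div_le l (2 * m)
    have hlT : l < 2 * m * (T + 1) := Nat.lt_mul_div_succ l (by omega)
    have hTl' : T ≤ l := Nat.div_le_self _ _
    have h1 : T * l ≤ 2 * ∑ j ∈ Finset.Icc 1 l, (l - m * j) := by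
      calc T * l = ∑ j ∈ Finset.Icc 1 T, l := by simp
        _ ≤ ∑ j ∈ Finset.Icc 1 T, 2 * (l - m * j) := by
            refine Finset.sum_le_sum fun j hj => ?_
            have : m * j ≤ m * T := Nat.mul_le_mul_left m (Finset.mem_Icc.1 hj).2
            have h3 : 2 * m * T = 2 * (m * T) := mul_assoc _ _ _
            omega
        _ ≤ ∑ j ∈ Finset.Icc 1 l, 2 * (l - m * j) :=
            Finset.sum_le_sum_of_subset (Finset.Icc_subset_Icc_right hTl')
        _ = _ := by rw [Finset.mul_sum]
    have h2 : l ≤ 4 * m * T := by nlinarith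
    calc l * l ≤ 4 * m * T * l := Nat.mul_le_mul_right l h2
      _ = 4 * m * (T * l) := by ring
      _ ≤ 4 * m * (2 * ∑ j ∈ Finset.Icc 1 l, (l - m * j)) := Nat.mul_le_mul_left _ h1
      _ = 8 * 1 * m * ∑ j ∈ Finset.Icc 1 l, (l - m * j) := by ring
      _ ≤ _ := by gcongr
  · have h1 : l - m ≤ ∑ j ∈ Finset.Icc 1 l, (l - m * j) := by
      have := Finset.single_le_sum (f := fun j => l - m * j) (fun _ _ => Nat.zero_le _)
        (Finset.mem_Icc.2 ⟨le_rfl, hm.trans hml⟩ : 1 ∈ Finset.Icc 1 l)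
      simpa using this
    calc l * l ≤ 8 * m * (q * (l - m)) := Nat.mul_le_mul (by omega) hq
      _ = 8 * q * m * (l - m) := by ring
      _ ≤ _ := Nat.mul_le_mul_left _ h1

/-- If all but `m` letters of the words with Parikh vector `P` are equal, their distances are
`O(m)`. -/
theorem overlapDist_le {P : Fin q → ℕ} {u v : List (Fin q)} (hu : HasContent P u)
    (hv : HasContent P v) {M : Fin q} {m : ℕ} (hm : 1 ≤ m) (hPM : P M + m = ∑ i, P i)
    (hM : ∑ i, P i ≤ q * P M) : overlapDist u v ≤ (8 * q * m : ℕ) := by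
  set l := ∑ i, P i with hl
  have hul := hu.length_eq
  have hvl := hv.length_eq
  rw [← hl] at hul hvl
  have hl0 : 0 < l := by omega
  have hu' := sum_replicate_le_subwords u M
  have hv' := sum_replicate_le_subwords v M
  rw [hul, hu M, show l - P M = m by omega] at hu'
  rw [hvl, hv M, show l - P M = m by omega] at hv'
  have hcard := Multiset.card_le_card (Multiset.le_inter hu' hv')
  rw [Multiset.card_sum] at hcard
  simp only [Multiset.card_replicate] at hcard
  have hsq := (sq_le_sum (q := q) hm (by omega) (by rwa [show l - m = P M by omega])).trans
    (Nat.mul_le_mul_left _ hcard)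
  refine (overlapDist_le_inv u v).trans ?_
  rw [overlapCoeff_eq hul hvl hl0,
    ENNReal.inv_div (Or.inl (ENNReal.natCast_ne_top _)) (Or.inl (by simp [hl0.ne']))]
  exact ENNReal.div_le_of_le_mul (by exact_mod_cast hsq)

end Upper

/-! ### Counting words with a given window -/

section Counting

variable {q : ℕ}

theorem multinomial_update_sub_mul_le {P : Fin q → ℕ} {i : Fin q} {a : ℕ} (ha : a ≤ P i) :
    Nat.multinomial Finset.univ (Function.update P i (P i - a)) * (∑ j, P j) ^ a ≤
      Nat.multinomial Finset.univ P * P i ^ a := by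
  induction a with
  | zero => simp
  | succ a ih =>
    set l := ∑ j, P j with hl
    set P' := Function.update P i (P i - a) with hP'
    have hP'i : P' i = P i - a := Function.update_self _ _ _
    have h1 := multinomial_update_mul (P := P') (c := i) (by omega)
    have h2 : Function.update P' i (P' i - 1) = Function.update P i (P i - (a + 1)) := by
      rw [hP'i, hP', Function.update_idem, Nat.sub_sub]
    have hPl : P i ≤ l := Finset.single_le_sum (fun _ _ => Nat.zero_le _) (Finset.mem_univ i)
    have hl' : ∑ j, P' j = l - a := by
      have h3 : P i + ∑ j ∈ Finset.univ.erase i, P j = l :=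
        Finset.add_sum_erase _ P (Finset.mem_univ i)
      rw [hP', Finset.sum_update_of_mem (Finset.mem_univ i), Finset.sdiff_singleton_eq_erase]
      omega
    rw [h2, hl', hP'i] at h1
    have ih := ih (by omega)
    set M := Nat.multinomial Finset.univ P
    set M' := Nat.multinomial Finset.univ P'
    set M'' := Nat.multinomial Finset.univ (Function.update P i (P i - (a + 1)))
    -- removing one more letter from a smaller supply can only lower the fraction
    have h4 : (P i - a) * l ≤ P i * (l - a) := by
      obtain ⟨b, hb⟩ := Nat.exists_eq_add_of_le (show a ≤ P i by omega)
      obtain ⟨c, hc⟩ := Nat.exists_eq_add_of_le hPl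
      rw [hc, hb, Nat.add_sub_cancel_left, show a + b + c - a = b + c by omega]
      nlinarith [Nat.zero_le (a * c)]
    refine Nat.le_of_mul_le_mul_right (c := l - a) ?_ (by omega)
    calc M'' * l ^ (a + 1) * (l - a) = M'' * (l - a) * l * l ^ a := by ring
      _ = M' * l ^ a * ((P i - a) * l) := by rw [h1]; ring
      _ ≤ M * P i ^ a * (P i * (l - a)) := Nat.mul_le_mul ih h4
      _ = M * P i ^ (a + 1) * (l - a) := by ring

/-- Deleting the copies of the letter `i` from the prefix `x` is injective on the words that start
with `x`. -/
theorem card_prefix_le (P : Fin q → ℕ) (x : List (Fin q)) (i : Fin q) :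
    ((contentWords P).filter fun y => x <+: y).card * (∑ j, P j) ^ x.count i ≤
      (contentWords P).card * P i ^ x.count i := by
  rcases lt_or_ge (P i) (x.count i) with hlt | hle
  · have : ((contentWords P).filter fun y => x <+: y) = ∅ := by
      rw [Finset.filter_eq_empty_iff]
      intro y hy hxy
      have := hxy.sublist.count_le i
      rw [mem_contentWords.1 hy i] at this
      omega
    simp [this]
  · rw [card_contentWords]
    refine le_trans (Nat.mul_le_mul_right _ ?_) (multinomial_update_sub_mul_le hle)
    rw [← card_contentWords]
    refine Finset.card_le_card_of_injOn (fun y => x.filter (· ≠ i) ++ y.drop x.length) ?_ ?_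
    · intro y hy
      simp only [Finset.coe_filter, mem_contentWords, Set.mem_ofPred_eq] at hy
      obtain ⟨hy, z, rfl⟩ := hy
      rw [Finset.mem_coe, mem_contentWords]
      intro c
      have hc := hy c
      rw [List.count_append] at hc
      simp only [List.drop_left, List.count_append]
      rcases eq_or_ne c i with rfl | hci
      · rw [Function.update_self, List.count_eq_zero.2 (by simp)]
        omega
      · rw [Function.update_of_ne hci, List.count_filter (by simpa using hci), hc]
    · intro y hy y' hy' h
      simp only [Finset.coe_filter, mem_contentWords, Set.mem_ofPred_eq] at hy hy'
      obtain ⟨-, z, rfl⟩ := hy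
      obtain ⟨-, z', rfl⟩ := hy'
      simpa using h

/-- By the pigeonhole principle some letter occurs at least `|x| / q` times in `x`; a word of
random order has this letter at these places with probability at most
`(1 - m / ℓ) ^ (|x| / q)`. -/
theorem card_prefix_le_exp {P : Fin q → ℕ} {m : ℕ} (hP : ∀ i, P i + m ≤ ∑ j, P j)
    (hl : 0 < ∑ j, P j) (x : List (Fin q)) :
    (((contentWords P).filter fun y => x <+: y).card : ℝ) ≤
      (contentWords P).card * Real.exp (-(m * x.length / (q * ∑ j, P j : ℕ))) := by
  set l := ∑ j, P j with hl'
  have hq : 0 < q := by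
    rcases Nat.eq_zero_or_pos q with rfl | h
    · simp at hl'; omega
    · exact h
  have : Nonempty (Fin q) := ⟨⟨0, hq⟩⟩
  obtain ⟨i, -, hi⟩ := Finset.exists_max_image Finset.univ (fun i => x.count i)
    Finset.univ_nonempty
  set a := x.count i with ha
  have hxa : x.length ≤ q * a := by
    have h1 : HasContent (fun i => x.count i) x := fun _ => rfl
    rw [h1.length_eq]
    simpa using Finset.sum_le_card_nsmul Finset.univ _ a hi
  have hlR : (0 : ℝ) < l := by exact_mod_cast hl
  have hqR : (0 : ℝ) < q := by exact_mod_cast hq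
  have h1 : (((contentWords P).filter fun y => x <+: y).card : ℝ) * (l : ℝ) ^ a ≤
      (contentWords P).card * (P i : ℝ) ^ a := by exact_mod_cast card_prefix_le P x i
  have h2 : (P i : ℝ) ≤ l * Real.exp (-(m / l)) := by
    have h3 : (P i : ℝ) + m ≤ l := by exact_mod_cast hP i
    have h4 := Real.add_one_le_exp (-((m : ℝ) / l))
    calc (P i : ℝ) ≤ l * (-(m / l) + 1) := by field_simp; linarith
      _ ≤ _ := by gcongr
  have h5 : (P i : ℝ) ^ a ≤ l ^ a * Real.exp (-(m * x.length / (q * l : ℕ))) := by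
    calc (P i : ℝ) ^ a ≤ (l * Real.exp (-(m / l))) ^ a := by gcongr
      _ = l ^ a * Real.exp (a * -(m / l)) := by rw [mul_pow, ← Real.exp_nat_mul]
      _ ≤ _ := by
        gcongr
        have h6 : (x.length : ℝ) ≤ q * a := by exact_mod_cast hxa
        push_cast
        rw [mul_neg, neg_le_neg_iff, div_le_iff₀ (by positivity)]
        calc (m : ℝ) * x.length ≤ m * (q * a) := by gcongr
          _ = a * (m / l) * (q * l) := by field_simp
  refine le_of_mul_le_mul_right (a := (l : ℝ) ^ a) ?_ (by positivity)
  calc _ ≤ _ := h1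
    _ ≤ (contentWords P).card * (l ^ a * Real.exp (-(m * x.length / (q * l : ℕ)))) := by gcongr
    _ = _ := by ring

theorem card_window_le (P : Fin q → ℕ) (x : List (Fin q)) (i : ℕ) :
    ((contentWords P).filter fun y => (y.rotate i).take x.length = x).card ≤
      ((contentWords P).filter fun y => x <+: y).card := by
  refine Finset.card_le_card_of_injOn (fun y => y.rotate i) ?_
    ((List.rotate_injective i).injOn)
  intro y hy
  simp only [Finset.coe_filter, mem_contentWords, Set.mem_ofPred_eq] at hy ⊢
  exact ⟨hy.1.rotate i, hy.2 ▸ List.take_prefix _ _⟩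

/-- Some word shares no cyclic window of length `J` with any of the words of `S`. -/
theorem exists_no_common_window {P : Fin q → ℕ} {m J : ℕ} (hP : ∀ i, P i + m ≤ ∑ j, P j)
    (hl : 0 < ∑ j, P j) (hJ : J ≤ ∑ j, P j) {S : Finset (List (Fin q))}
    (hS : ∀ s ∈ S, HasContent P s)
    (hsmall : (S.card * (∑ j, P j) ^ 2 : ℕ) *
      Real.exp (-(m * J / (q * ∑ j, P j : ℕ))) < 1) :
    ∃ y, HasContent P y ∧ ∀ s ∈ S, ∀ i < ∑ j, P j, ∀ i' < ∑ j, P j,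
      (y.rotate i).take J ≠ (s.rotate i').take J := by
  set l := ∑ j, P j with hl'
  by_contra! hcon
  set ε := Real.exp (-(m * J / (q * l : ℕ))) with hε
  have hsub : contentWords P ⊆ (S ×ˢ Finset.range l ×ˢ Finset.range l).biUnion fun t =>
      (contentWords P).filter fun y => (y.rotate t.2.1).take J = (t.1.rotate t.2.2).take J := by
    intro y hy
    obtain ⟨s, hs, i, hi, i', hi', h⟩ := hcon y (mem_contentWords.1 hy)
    simp only [Finset.mem_biUnion, Finset.mem_product, Finset.mem_range, Finset.mem_filter]
    exact ⟨(s, i, i'), ⟨hs, hi, hi'⟩, hy, h⟩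
  have hterm : ∀ t ∈ S ×ˢ Finset.range l ×ˢ Finset.range l,
      (((contentWords P).filter fun y =>
        (y.rotate t.2.1).take J = (t.1.rotate t.2.2).take J).card : ℝ) ≤
        (contentWords P).card * ε := by
    intro t ht
    have hlen : ((t.1.rotate t.2.2).take J).length = J := by
      have := (hS t.1 (Finset.mem_product.1 ht).1).length_eq
      simp only [List.length_take, List.length_rotate]
      omega
    have h1 := card_window_le P ((t.1.rotate t.2.2).take J) t.2.1
    have h2 := card_prefix_le_exp hP hl ((t.1.rotate t.2.2).take J)
    rw [hlen] at h1 h2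
    exact (Nat.cast_le.2 h1).trans h2
  have hpos : 0 < ((contentWords P).card : ℝ) := by
    rw [card_contentWords]; exact_mod_cast Nat.multinomial_pos _ _
  have : ((contentWords P).card : ℝ) ≤
      (contentWords P).card * ((S.card * l ^ 2 : ℕ) * ε) := by
    calc ((contentWords P).card : ℝ) ≤ ∑ t ∈ S ×ˢ Finset.range l ×ˢ Finset.range l,
          (((contentWords P).filter fun y =>
            (y.rotate t.2.1).take J = (t.1.rotate t.2.2).take J).card : ℝ) := by
          exact_mod_cast (Finset.card_le_card hsub).trans Finset.card_biUnion_le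
      _ ≤ ∑ t ∈ S ×ˢ Finset.range l ×ˢ Finset.range l, (contentWords P).card * ε :=
          Finset.sum_le_sum hterm
      _ = _ := by
          rw [Finset.sum_const, nsmul_eq_mul, Finset.card_product, Finset.card_product,
            Finset.card_range]
          push_cast
          ring
  nlinarith

end Counting

/-! ### Lower bound for the optimum -/

section Lower

variable {q : ℕ}

theorem fixedContent_subset (P : Fin q → ℕ) :
    fixedContent P ⊆ (contentWords P : Set (List (Fin q))) := fun _ hx =>
  Finset.mem_coe.2 (mem_contentWords.2 hx.2)

theorem finite_fixedContent (P : Fin q → ℕ) : (fixedContent P).Finite :=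
  (contentWords P).finite_toSet.subset (fixedContent_subset P)

theorem one_le_maxDist {P : Fin q → ℕ} (hl : 0 < ∑ i, P i) {S : Finset (List (Fin q))}
    (hS : (S : Set (List (Fin q))) ⊆ fixedContent P) (hcard : S.card < (fixedContent P).ncard) :
    1 ≤ maxDist (fixedContent P) S := by
  obtain ⟨v, hv, hvS⟩ : ∃ v ∈ fixedContent P, v ∉ S := by
    by_contra! h
    have := Set.ncard_le_ncard (t := (S : Set (List (Fin q)))) (fun v hv => h v hv)
      S.finite_toSet
    rw [Set.ncard_coe_finset] at this
    omega
  refine le_iSup₂_of_le v hv (le_iInf₂ fun s hs => ?_)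
  have hs' := hS hs
  have hsl := length_of_mem_fixedContent hs'
  have hvl := length_of_mem_fixedContent hv
  rw [overlapDist_eq_inv fun h =>
    hvS (eq_of_overlapCoeff_eq_one hsl hvl hl hs'.1 hv.1 h ▸ hs)]
  exact ENNReal.one_le_inv.2 (overlapCoeff_le_one hsl hvl hl)

/-- A random word shares no long windows with `k` given words, so the optimum is at least
`m / (q log (k ℓ²))` if, for every letter, at least `m` of the `ℓ` letters of a word differ from
it. -/
theorem le_optDist {P : Fin q → ℕ} {k m : ℕ} (hm : 1 ≤ m) (hP : ∀ i, P i + m ≤ ∑ j, P j)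
    (hl : 2 ≤ ∑ j, P j) (hk : 1 ≤ k) (hkL : k < (fixedContent P).ncard) :
    ENNReal.ofReal (m / (q * Real.log (k * (∑ j, P j : ℕ) ^ 2))) ≤
      optDist (fixedContent P) k := by
  set l := ∑ j, P j with hl'
  have hq : 0 < q := by
    rcases Nat.eq_zero_or_pos q with rfl | h
    · simp at hl'; omega
    · exact h
  refine le_iInf₂ fun S hS => ?_
  obtain ⟨hSL, hSk⟩ := hS
  have hlR : (2 : ℝ) ≤ l := by exact_mod_cast hl
  have hkR : (1 : ℝ) ≤ k := by exact_mod_cast hk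
  have hmR : (1 : ℝ) ≤ m := by exact_mod_cast hm
  have hqR : (0 : ℝ) < q := by exact_mod_cast hq
  set X : ℝ := k * (l : ℝ) ^ 2 with hX
  have hX1 : 1 < X := by nlinarith
  have hlog : 0 < Real.log X := Real.log_pos hX1
  set Λ : ℝ := q * Real.log X with hΛ
  have hΛ0 : 0 < Λ := by positivity
  set J : ℕ := ⌊l * Λ / m⌋₊ + 1 with hJ
  have hJlt : l * Λ / m < J := by
    rw [hJ]; push_cast; exact Nat.lt_floor_add_one _
  have hJle : ((J - 1 : ℕ) : ℝ) ≤ l * Λ / m := by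
    rw [hJ, Nat.add_sub_cancel]
    exact Nat.floor_le (by positivity)
  rcases le_or_gt J l with hJl | hJl
  · have hsmall : (S.card * l ^ 2 : ℕ) * Real.exp (-(m * J / (q * l : ℕ))) < 1 := by
      have h1 : Real.log X < m * J / (q * l : ℕ) := by
        push_cast
        rw [lt_div_iff₀ (by positivity)]
        rw [div_lt_iff₀ (by positivity)] at hJlt
        calc Real.log X * (q * l) = l * Λ := by rw [hΛ]; ring
          _ < J * m := hJlt
          _ = m * J := mul_comm _ _
      rw [hSk]
      push_cast at h1 ⊢
      rw [Real.exp_neg, ← div_eq_mul_inv, div_lt_one (Real.exp_pos _)]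
      exact (Real.log_lt_iff_lt_exp (by positivity)).1 h1
    obtain ⟨y, hy, hyS⟩ := exists_no_common_window hP (by omega) hJl
      (fun s hs => (hSL hs).2) hsmall
    obtain ⟨r, hr⟩ := exists_isNecklace_rotate y
    have hv : y.rotate r ∈ fixedContent P := ⟨hr, hy.rotate r⟩
    refine le_iSup₂_of_le (y.rotate r) hv (le_iInf₂ fun s hs => ?_)
    have hsl : s.length = l := length_of_mem_fixedContent (hSL hs)
    have hvl : (y.rotate r).length = l := length_of_mem_fixedContent hv
    have hcard := card_inter_subwords_le hsl hvl (show 1 ≤ J by omega) fun i hi i' hi' h => by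
      rw [List.rotate_rotate, ← List.rotate_mod y (r + i')] at h
      exact hyS s hs _ (by rw [hy.length_eq]; exact Nat.mod_lt _ (by omega)) i hi h.symm
    have hcoeff : overlapCoeff s (y.rotate r) ≤ ENNReal.ofReal (Λ / m) := by
      rw [overlapCoeff_eq hsl hvl (by omega)]
      refine ENNReal.div_le_of_le_mul ?_
      rw [← ENNReal.ofReal_natCast (l * l), ← ENNReal.ofReal_mul (by positivity),
        ← ENNReal.ofReal_natCast]
      refine ENNReal.ofReal_le_ofReal ?_
      calc ((subwords s ∩ subwords (y.rotate r)).card : ℝ) ≤ (l * (J - 1) : ℕ) := by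
            exact_mod_cast hcard
        _ ≤ l * (l * Λ / m) := by push_cast; gcongr
        _ = Λ / m * (l * l : ℕ) := by push_cast; ring
    have hne : overlapCoeff s (y.rotate r) ≠ 1 := by
      rw [overlapCoeff_eq hsl hvl (by omega), Ne,
        ENNReal.div_eq_one_iff (by positivity) (ENNReal.natCast_ne_top _), Nat.cast_inj]
      have : l * (J - 1) < l * l := Nat.mul_lt_mul_of_pos_left (by omega) (by omega)
      omega
    rw [overlapDist_eq_inv hne, ← inv_div Λ (m : ℝ), ENNReal.ofReal_inv_of_pos (by positivity)]
    exact ENNReal.inv_le_inv.2 hcoeff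
  · -- windows of this length do not exist, and the bound is at most `1`
    refine le_trans ?_ (one_le_maxDist (by omega) hSL (by omega))
    rw [← ENNReal.ofReal_one]
    refine ENNReal.ofReal_le_ofReal ?_
    have h1 : (l : ℝ) ≤ (J - 1 : ℕ) := by exact_mod_cast (by omega : l ≤ J - 1)
    have h2 := h1.trans hJle
    rw [le_div_iff₀ (by positivity)] at h2
    rw [div_le_one hΛ0]
    exact le_of_mul_le_mul_left h2 (by positivity)

end Lower

/-! ### The approximation factor -/

section Ratio

/-- Each of the three logarithms is bounded by a multiple of `(k l) ^ δ` with `3 δ = 2 / q`. -/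
theorem log_mul_logb_sq_le {q : ℕ} (hq : 2 ≤ q) : ∃ C : ℝ, 0 < C ∧ ∀ k l : ℕ, 1 ≤ k → 1 ≤ l →
    Real.log (k * (l : ℝ) ^ 2) * Real.logb q (k * q) ^ 2 ≤
      C * ((k : ℝ) * l) ^ (2 / (q : ℝ)) := by
  have hqR : (2 : ℝ) ≤ q := by exact_mod_cast hq
  set δ : ℝ := 2 / (q : ℝ) / 3 with hδ
  have hδ0 : 0 < δ := by positivity
  refine ⟨2 / δ * (1 + 2 / δ) ^ 2, by positivity, fun k l hk hl => ?_⟩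
  have hkR : (1 : ℝ) ≤ k := by exact_mod_cast hk
  have hlR : (1 : ℝ) ≤ l := by exact_mod_cast hl
  set x : ℝ := k * l with hx
  have hkx : (k : ℝ) ≤ x := by nlinarith
  have hx1 : 1 ≤ x := hkR.trans hkx
  set z : ℝ := x ^ δ with hz
  have hz1 : 1 ≤ z := Real.one_le_rpow hx1 hδ0.le
  have hlogx : Real.log x ≤ z / δ := Real.log_le_rpow_div (by positivity) hδ0
  have h1 : Real.log (k * (l : ℝ) ^ 2) ≤ 2 / δ * z := by
    calc Real.log (k * (l : ℝ) ^ 2) ≤ Real.log (x ^ 2) := by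
          refine Real.log_le_log (by positivity) ?_
          rw [hx, mul_pow]
          gcongr
          nlinarith
      _ = 2 * Real.log x := by rw [Real.log_pow]; norm_num
      _ ≤ 2 * (z / δ) := by gcongr
      _ = 2 / δ * z := by ring
  have hlogq : 1 / 2 ≤ Real.log q := by
    have h2 := Real.log_two_gt_d9
    have h3 := Real.log_le_log two_pos hqR
    linarith
  have h2 : Real.logb q (k * q) ≤ (1 + 2 / δ) * z := by
    rw [Real.logb_mul (by positivity) (by positivity), Real.logb_self_eq_one (by linarith)]
    have h3 : Real.logb q k ≤ 2 * Real.log x := by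
      rw [Real.logb, div_le_iff₀ (by linarith)]
      have h4 : Real.log k ≤ Real.log x := Real.log_le_log (by positivity) hkx
      have h5 : 0 ≤ Real.log x := Real.log_nonneg hx1
      nlinarith
    calc Real.logb q k + 1 ≤ 2 * (z / δ) + z := by linarith
      _ = (1 + 2 / δ) * z := by ring
  have h3 : 0 ≤ Real.logb q (k * q) :=
    Real.logb_nonneg (by linarith) (by nlinarith)
  have hz3 : z ^ 3 = x ^ (2 / (q : ℝ)) := by
    rw [hz, ← Real.rpow_natCast, ← Real.rpow_mul (by positivity), hδ]
    congr 1
    push_cast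
    ring
  calc Real.log (k * (l : ℝ) ^ 2) * Real.logb q (k * q) ^ 2
      ≤ 2 / δ * z * ((1 + 2 / δ) * z) ^ 2 := by gcongr
    _ = 2 / δ * (1 + 2 / δ) ^ 2 * z ^ 3 := by ring
    _ = _ := by rw [hz3]

theorem maxDist_self {q : ℕ} {P : Fin q → ℕ} (hl : 0 < ∑ i, P i) {S : Finset (List (Fin q))}
    (hS : (S : Set (List (Fin q))) = fixedContent P) : maxDist (fixedContent P) S = 0 := by
  refine le_antisymm (iSup₂_le fun v hv => ?_) zero_le
  have hv0 : v ≠ [] := by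
    rintro rfl
    have := length_of_mem_fixedContent hv
    simp at this
    omega
  refine iInf₂_le_of_le v ?_ (overlapDist_self hv0).le
  rw [← hS] at hv
  exact hv

theorem eq_replicate_of_hasContent {q : ℕ} {P : Fin q → ℕ} {M : Fin q} (hM : P M = ∑ i, P i)
    {x : List (Fin q)} (hx : HasContent P x) : x = List.replicate (∑ i, P i) M := by
  rw [← hx.length_eq] at hM ⊢
  rw [List.eq_replicate_length]
  intro c hc
  exact ((List.count_eq_length.1 ((hx M).trans hM)) c hc).symm

/-- Any `k` necklaces are as good a choice of centres as claimed: all distances are `O(m)`, for `m`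
the number of letters other than the most frequent one, and the optimum is at least
`m / O(log (k ℓ))`. -/
theorem exists_ratio_bound (q : ℕ) [NeZero q] (hq : 2 ≤ q) :
    ∃ C : ℝ, 0 < C ∧ ∀ (P : Fin q → ℕ) (k : ℕ), 1 ≤ ∑ i, P i → 1 ≤ k →
      ∀ S : Finset (List (Fin q)), (S : Set (List (Fin q))) ⊆ fixedContent P → S.card = k →
      maxDist (fixedContent P) S ≤
        ENNReal.ofReal (C * (((k : ℝ) * (∑ i, P i : ℕ)) ^ (2 / (q : ℝ)) /
          Real.logb q (k * q) ^ 2)) * optDist (fixedContent P) k := by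
  obtain ⟨C, hC, hbound⟩ := log_mul_logb_sq_le hq
  refine ⟨8 * q * q * C, by positivity, fun P k hl hk S hSL hSk => ?_⟩
  set l := ∑ i, P i with hl'
  have hkL : k ≤ (fixedContent P).ncard := by
    rw [← hSk, ← Set.ncard_coe_finset]
    exact Set.ncard_le_ncard hSL (finite_fixedContent P)
  rcases hkL.eq_or_lt with hkL | hkL
  · have : (S : Set (List (Fin q))) = fixedContent P :=
      Set.eq_of_subset_of_ncard_le hSL (by rw [Set.ncard_coe_finset]; omega)
        (finite_fixedContent P)
    rw [maxDist_self hl this]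
    exact zero_le
  obtain ⟨M, -, hM⟩ := Finset.exists_max_image Finset.univ P ⟨0, Finset.mem_univ _⟩
  have hMl : P M ≤ l := Finset.single_le_sum (fun _ _ => Nat.zero_le _) (Finset.mem_univ M)
  have hlM : l ≤ q * P M := by simpa using Finset.sum_le_card_nsmul Finset.univ P _ hM
  obtain ⟨m, hm⟩ := Nat.exists_eq_add_of_le hMl
  have hm1 : 1 ≤ m := by
    by_contra h
    have hPM : P M = ∑ i, P i := by omega
    obtain ⟨u, v, hu, hv, huv⟩ := (Set.one_lt_ncard_iff (finite_fixedContent P)).1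
      (show 1 < (fixedContent P).ncard by omega)
    exact huv ((eq_replicate_of_hasContent hPM hu.2).trans
      (eq_replicate_of_hasContent hPM hv.2).symm)
  have hl2 : 2 ≤ l := by
    rcases Nat.eq_zero_or_pos (P M) with h | h
    · rw [h] at hlM; omega
    · omega
  have hmax : maxDist (fixedContent P) S ≤ (8 * q * m : ℕ) := by
    refine iSup₂_le fun v hv => ?_
    obtain ⟨s, hs⟩ := Finset.card_pos.1 (by omega : 0 < S.card)
    exact iInf₂_le_of_le s hs (overlapDist_le (hSL hs).2 hv.2 hm1 hm.symm hlM)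
  have hopt := le_optDist hm1 (fun i => by have := hM i (Finset.mem_univ i); omega) hl2 hk hkL
  rw [← hl'] at hopt
  set X : ℝ := k * (l : ℝ) ^ 2 with hX
  have hlR : (2 : ℝ) ≤ l := by exact_mod_cast hl2
  have hkR : (1 : ℝ) ≤ k := by exact_mod_cast hk
  have hqR : (2 : ℝ) ≤ q := by exact_mod_cast hq
  have hX1 : 1 < X := by nlinarith
  have hlog : 0 < Real.log X := Real.log_pos hX1
  have hlogb : 0 < Real.logb q (k * q) := Real.logb_pos (by linarith) (by nlinarith)
  have hfactor : Real.log X ≤ C * (((k : ℝ) * l) ^ (2 / (q : ℝ)) / Real.logb q (k * q) ^ 2) := by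
    rw [← mul_div_assoc, le_div_iff₀ (by positivity)]
    exact hbound k l hk hl
  refine hmax.trans (le_trans ?_ (mul_le_mul_right hopt _))
  rw [← ENNReal.ofReal_mul (by positivity), ← ENNReal.ofReal_natCast]
  refine ENNReal.ofReal_le_ofReal ?_
  calc ((8 * q * m : ℕ) : ℝ) = 8 * q * q * Real.log X * (m / (q * Real.log X)) := by
        push_cast; field_simp
    _ ≤ 8 * q * q * (C * (((k : ℝ) * l) ^ (2 / (q : ℝ)) / Real.logb q (k * q) ^ 2)) *
        (m / (q * Real.log X)) := by gcongr
    _ = _ := by ring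

end Ratio

end Necklace

theorem mainTheorem6 (q : ℕ) [NeZero q] (hq : 2 ≤ q) :
    (∃ C : ℝ, 0 < C ∧ ∀ (P : Fin q → ℕ) (k ℓ : ℕ), ℓ = ∑ i, P i → 1 ≤ ℓ →
      1 ≤ k → k ≤ (Necklace.fixedContent P).ncard →
      ∃ S : Finset (List (Fin q)), S = (Necklace.prefixTreeCentres P k).val.toFinset ∧
        (S : Set (List (Fin q))) ⊆ Necklace.fixedContent P ∧ S.card = k ∧
        Necklace.maxDist (Necklace.fixedContent P) S ≤
          ENNReal.ofReal (C * (((k : ℝ) * ℓ) ^ (2 / (q : ℝ)) / Real.logb q (k * q) ^ 2)) *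
            Necklace.optDist (Necklace.fixedContent P) k) ∧
    (∃ A D : ℕ, ∀ (P : Fin q → ℕ) (k ℓ : ℕ), ℓ = ∑ i, P i → 1 ≤ ℓ →
      1 ≤ k → k ≤ (Necklace.fixedContent P).ncard →
      (Necklace.prefixTreeCentres P k).cost ≤ A * (k * ℓ) ^ D) := by
  constructor
  · obtain ⟨C, hC, h⟩ := Necklace.exists_ratio_bound q hq
    refine ⟨C, hC, fun P k l hPl hl hk hkL => ?_⟩
    subst hPl
    obtain ⟨h1, h2⟩ := Necklace.prefixTreeCentres_val hk hkL
    exact ⟨_, rfl, h1, h2, h P k hl hk _ h1 h2⟩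
  · obtain ⟨A, D, h⟩ := Necklace.exists_cost_bound q
    exact ⟨A, D, fun P k l hPl hl hk _ => hPl ▸ h P k (hPl ▸ hl) hk⟩
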